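/- For a word $w=(s_1,\ldots,s_r)$ of positive integers let $\mathrm H_w(N)=\sum_{N\ge n_1>\cdots>n_r>0}n_1^{-s_1}\cdots n_r^{-s_r}$ and, when the series converges, $\zeta(w)=\sum_{n_1>\cdots>n_r>0}n_1^{-s_1}\cdots n_r^{-s_r}$ (both equal to $1$ for the empty word). Let $\gamma_w$ be the finite part of $\mathrm H_w(n)$ as $n\to\infty$, i.e. the constant term of the polynomial $P$ with $\mathrm H_w(n)=P(\log n)+o(1)$. Write $\{w\}^k$ for $w$ repeated $k$ times, and for $c\in\mathbb C$ put $\gamma_{(c\,w)^*}=\sum_{k\ge0}c^k\gamma_{\{w\}^k}$ and $\zeta((c\,w)^*)=\sum_{k\ge0}c^k\zeta(\{w\}^k)$. For $|z|<1$ let $$\ell_1(z)=\gamma z-\sum_{k\ge2}\zeta(k)\frac{(-z)^k}{k},\qquad \ell_r(z)=-\sum_{k\ge1}\zeta(kr)\frac{(-z^r)^k}{k}\ (r\ge2),\qquad \Gamma_{y_r}(1+z)=e^{-\ell_r(z)},$$ where $\gamma$ is Euler's constant; $y_s$ denotes the one-letter word $(s)$ and $y_3y_1$ the word $(3,1)$.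 For all $r\ge1$, $k\ge0$ the finite part $\gamma_{\{r\}^k}$ exists, and the following hold. 1. For every $t\in\mathbb C$ with $|t|<1$ all the series involved converge, and $$\gamma_{(-t^2y_2)^*}=\Gamma_{y_2}^{-1}(1+\mathrm it),\quad \gamma_{(ty_1)^*}=\Gamma_{y_1}^{-1}(1+t),\quad \gamma_{(-ty_1)^*}=\Gamma_{y_1}^{-1}(1-t),$$ $$\gamma_{(-t^2y_2)^*}=\gamma_{(ty_1)^*}\gamma_{(-ty_1)^*},\quad\text{that is}\quad \Gamma_{y_2}^{-1}(1+\mathrm it)=\Gamma_{y_1}^{-1}(1+t)\,\Gamma_{y_1}^{-1}(1-t),$$ $$\Gamma_{y_2}^{-1}(1+\mathrm it)=e^{-\sum_{k\ge1}\zeta(2k)t^{2k}/k}=\frac{\sin(t\pi)}{t\pi},\qquad \gamma_{(-t^2y_2)^*}=\zeta((-t^2y_2)^*)=\sum_{k\ge0}\frac{(t\mathrm i\pi)^{2k}}{(2k+1)!}$$ (the quotient with $t$ in the denominator for $t\neq0$). 2. For every $t\in\mathbb C$ with $|t|<1$ and every $\xi$ with $\xi^4=-1$ all the series involved converge, and $$\gamma_{(-t^4y_4)^*}=\Gamma_{y_4}^{-1}(1+\xi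 t)=\Gamma_{y_2}^{-1}(1+t)\,\Gamma_{y_2}^{-1}(1+\mathrm it),\quad \gamma_{(t^2y_2)^*}=\Gamma_{y_2}^{-1}(1+t),\quad \gamma_{(-t^4y_4)^*}=\gamma_{(t^2y_2)^*}\gamma_{(-t^2y_2)^*},$$ $$\gamma_{(-t^4y_4)^*}=e^{-\sum_{k\ge1}\zeta(4k)t^{4k}/k}=\frac{\sin(\mathrm it\pi)}{\mathrm it\pi}\,\frac{\sin(t\pi)}{t\pi},\qquad \gamma_{(-t^4y_4)^*}=\zeta((-t^4y_4)^*),\quad \gamma_{(t^2y_2)^*}=\zeta((t^2y_2)^*),$$ $$\zeta((-t^4y_4)^*)=\zeta((-t^2y_2)^*)\,\zeta((t^2y_2)^*)=\zeta((-4t^4y_3y_1)^*)=\sum_{k\ge0}\frac{2(-4)^k(t\pi)^{4k}}{(4k+2)!}$$ (again the quotients for $t\neq0$). 3. For every $k\ge0$ the series $\zeta(\{2\}^k)$, $\zeta(\{4\}^k)$, $\zeta(\{3,1\}^k)$ converge, and $$\frac{\zeta(\{2\}^k)}{\pi^{2k}}=\frac1{(2k+1)!}\in\mathbb Q,\qquad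 \frac{\zeta(\{4\}^k)}{4^k\pi^{4k}}=\frac{\zeta(\{3,1\}^k)}{\pi^{4k}}=\frac{2}{(4k+2)!}\in\mathbb Q.$$ -/

import Mathlib

open Filter Topology

noncomputable section

namespace Polyzeta

/-- Words `y_{s_1} ... y_{s_r}` over the alphabet `Y = {y_s}_{s ≥ 1}` are lists `[s_1, ..., s_r]`;
`wordPow w k` is the word `w` repeated `k` times, e.g. `wordPow [3, 1] k = {3,1}^k`. -/
def wordPow (w : List ℕ) (k : ℕ) : List ℕ := (List.replicate k w).flatten

/-- The index set `n_1 > ... > n_r > 0`. -/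
abbrev Decreasing (r : ℕ) : Type := {n : Fin r → ℕ // StrictAnti n ∧ ∀ i, 0 < n i}

/-- The general term `n_1^{-s_1} ... n_r^{-s_r}`. -/
def term (s : List ℕ) (n : Fin s.length → ℕ) : ℝ := ∏ i, ((n i : ℝ) ^ s.get i)⁻¹

/-- The series over `n_1 > ... > n_r > 0` that defines `ζ(s_1, ..., s_r)` converges. -/
def Converges (s : List ℕ) : Prop := Summable fun n : Decreasing s.length => term s n.1

/-- The polyzeta `ζ(s_1, ..., s_r)`, the sum over `n_1 > ... > n_r > 0` of
`n_1^{-s_1} ... n_r^{-s_r}`. -/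
def zeta (s : List ℕ) : ℝ := ∑' n : Decreasing s.length, term s n.1

open Classical in
/-- The harmonic sum `H_{s_1, ..., s_r}(N)`, the sum over `N ≥ n_1 > ... > n_r > 0`. -/
def harmonicSum (s : List ℕ) (N : ℕ) : ℝ :=
  ∑ n ∈ (Fintype.piFinset fun _ : Fin s.length => Finset.Icc 1 N).filter StrictAnti, term s n

/-- `c` is the finite part of `u` as `n → ∞` in the scale of the powers of `log n`:
`u n = P (log n) + o(1)` for a polynomial `P` with constant term `c`. (For harmonic sums with positive
indices no positive power of `n` occurs, and the terms with a negative power of `n` are `o(1)`.) -/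
def IsFinitePart (u : ℕ → ℝ) (c : ℝ) : Prop :=
  ∃ P : Polynomial ℝ, P.coeff 0 = c ∧
    Tendsto (fun n : ℕ => u n - P.eval (Real.log n)) atTop (𝓝 0)

/-- The finite part is unique. -/
theorem IsFinitePart.unique {u : ℕ → ℝ} {c d : ℝ} (hc : IsFinitePart u c)
    (hd : IsFinitePart u d) : c = d := by
  obtain ⟨P, rfl, hP⟩ := hc
  obtain ⟨Q, rfl, hQ⟩ := hd
  have hlog : Tendsto (fun n : ℕ => Real.log n) atTop atTop :=
    Real.tendsto_log_atTop.comp tendsto_natCast_atTop_atTop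
  have h : Tendsto (fun n : ℕ => (P - Q).eval (Real.log n)) atTop (𝓝 0) := by
    have := hQ.sub hP
    simp only [sub_zero] at this
    refine this.congr fun n => ?_
    simp
  by_cases hdeg : 0 < (P - Q).degree
  · have h2 := ((P - Q).abs_tendsto_atTop hdeg).comp hlog
    exact absurd h.abs (not_tendsto_nhds_of_tendsto_atTop h2 _)
  · rw [Polynomial.eq_C_of_degree_le_zero (not_lt.mp hdeg)] at h
    simp only [Polynomial.eval_C] at h
    have := tendsto_nhds_unique h tendsto_const_nhds
    simp only [Polynomial.coeff_sub] at this
    linarith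

open Classical in
/-- The regularization `γ_w`, the finite part of `H_w(n)` as `n → ∞` in the scale of the powers
of `log n` (so `γ_{y_1}` is Euler's constant). -/
def gammaReg (w : List ℕ) : ℝ :=
  if h : ∃ c, IsFinitePart (harmonicSum w) c then h.choose else 0

/-- The degreewise evaluation of `χ` at the Kleene star `(c w)^* = ∑_k c^k w^k` converges. -/
def StarConverges (χ : List ℕ → ℝ) (c : ℂ) (w : List ℕ) : Prop :=
  Summable fun k : ℕ => c ^ k * (χ (wordPow w k) : ℂ)

/-- The value of `χ` at the Kleene star `(c w)^* = ∑_k c^k w^k`. -/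
def starValue (χ : List ℕ → ℝ) (c : ℂ) (w : List ℕ) : ℂ :=
  ∑' k : ℕ, c ^ k * (χ (wordPow w k) : ℂ)

/-- `ℓ_1(z) = γ z - ∑_{k ≥ 2} ζ(k) (-z)^k / k`, and `ℓ_r(z) = - ∑_{k ≥ 1} ζ(k r) (-z^r)^k / k` for
`r ≥ 2`; used for `|z| < 1` only. -/
def ell (r : ℕ) (z : ℂ) : ℂ :=
  if r = 1 then
    Real.eulerMascheroniConstant * z
      - ∑' k : ℕ, riemannZeta ((k + 2 : ℕ) : ℂ) * (-z) ^ (k + 2) / ((k + 2 : ℕ) : ℂ)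
  else
    - ∑' k : ℕ, riemannZeta (((k + 1) * r : ℕ) : ℂ) * (-z ^ r) ^ (k + 1) / ((k + 1 : ℕ) : ℂ)

/-- The eulerian function `Γ_{y_r}`, with `Γ_{y_r}(1 + z) = exp (-ℓ_r(z))` for `|z| < 1`. -/
def GammaY (r : ℕ) (a : ℂ) : ℂ := Complex.exp (-ell r (a - 1))

end Polyzeta

end

/-! For fixed r, the sums H over {r}^k up to N are the elementary symmetric functions of 1, 2^{-r},
..., N^{-r}, so Newton's identities express them through power sums. Each power sum is a constant,
or log N + γ when the exponent is 1, up to an error of at most 1/N. Such errors survive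
multiplication by powers of log N, so taking constant terms turns Newton's identities into the same
recurrence for the finite parts, with ζ(rj) in place of the power sums and γ in place of the
divergent ζ(1). For the generating function F of the finite parts the recurrence reads F' = F·S,
hence F is an exponential (`hasSum_exp_of_recurrence`), and in the variable z^r it is exp(ℓ_r(z)).
The reflection formula is then the cancellation of the odd powers of t in ℓ_1(t) + ℓ_1(-t).

For r ≥ 2 the finite parts are the convergent values ζ({r}^k), whose generating function is also the
product of the 1 + c/j^r. Euler's sine product evaluates it for r = 2, and the factorization 1 -
t^4/j^4 = (1 - t^2/j^2)(1 + t^2/j^2) for r = 4. Comparing Taylor coefficients gives ζ({2}^k) and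
ζ({4}^k).

The words {3,1}^k are reached through the shuffle identity (Σ T^k Li_{{2}^k})(Σ (-T)^k Li_{{2}^k}) =
Σ (-4T^2)^k Li_{{3,1}^k}, proved for formal power series in `wordSeries_two_mul_wordSeries_two`: the
difference of the two sides belongs to a homogeneous linear differential system with zero initial
values. Summing the coefficients in z, that is, setting z = 1, writes (-4)^k ζ({3,1}^k) as an
alternating convolution of the ζ({2}^i), which is a Taylor coefficient of a product of two sines. -/

noncomputable section

namespace Polyzeta


/-! ### Harmonic sums by recursion, and zeta series as their limits -/

/-- Harmonic sums, defined by recursion on the word. -/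
def hsum : List ℕ → ℕ → ℝ
  | [], _ => 1
  | s :: w, N => ∑ m ∈ Finset.range N, (((m + 1 : ℕ) : ℝ) ^ s)⁻¹ * hsum w m

@[simp] theorem hsum_nil (N : ℕ) : hsum [] N = 1 := rfl

theorem hsum_cons (s : ℕ) (w : List ℕ) (N : ℕ) :
    hsum (s :: w) N = ∑ m ∈ Finset.range N, (((m + 1 : ℕ) : ℝ) ^ s)⁻¹ * hsum w m := rfl

@[simp] theorem hsum_cons_zero (s : ℕ) (w : List ℕ) : hsum (s :: w) 0 = 0 := by simp [hsum_cons]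

theorem hsum_cons_succ (s : ℕ) (w : List ℕ) (N : ℕ) :
    hsum (s :: w) (N + 1) = hsum (s :: w) N + (((N + 1 : ℕ) : ℝ) ^ s)⁻¹ * hsum w N := by
  simp only [hsum_cons, Finset.sum_range_succ]

theorem hsum_nonneg (w : List ℕ) (N : ℕ) : 0 ≤ hsum w N := by
  induction w generalizing N with
  | nil => simp
  | cons s w ih => exact Finset.sum_nonneg fun m _ => mul_nonneg (by positivity) (ih m)

theorem hsum_mono (w : List ℕ) : Monotone (hsum w) := by
  cases w with
  | nil => exact monotone_const
  | cons s w =>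
    refine monotone_nat_of_le_succ fun N => ?_
    rw [hsum_cons_succ]
    have := hsum_nonneg w N
    have : 0 ≤ (((N + 1 : ℕ) : ℝ) ^ s)⁻¹ * hsum w N := by positivity
    linarith

open Classical in
/-- The index set `N ≥ n_1 > ... > n_r > 0` as a finite set. -/
def decreasingUpTo (r N : ℕ) : Finset (Fin r → ℕ) :=
  (Fintype.piFinset fun _ : Fin r => Finset.Icc 1 N).filter StrictAnti

theorem mem_decreasingUpTo {r N : ℕ} {n : Fin r → ℕ} :
    n ∈ decreasingUpTo r N ↔ (∀ i, 0 < n i ∧ n i ≤ N) ∧ StrictAnti n := by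
  simp [decreasingUpTo, Fintype.mem_piFinset, Nat.succ_le_iff]

theorem strictAnti_cons {r : ℕ} {a : ℕ} {f : Fin r → ℕ} :
    StrictAnti (Fin.cons a f : Fin (r + 1) → ℕ) ↔ (∀ i, f i < a) ∧ StrictAnti f := by
  constructor
  · intro h
    refine ⟨fun i => ?_, fun i j hij => ?_⟩
    · simpa using h (Fin.succ_pos i)
    · simpa using h (Fin.succ_lt_succ_iff.2 hij)
  · rintro ⟨h1, h2⟩ i j hij
    induction i using Fin.cases with
    | zero =>
      induction j using Fin.cases with
      | zero => exact absurd hij (lt_irrefl _)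
      | succ j => simpa using h1 j
    | succ i =>
      induction j using Fin.cases with
      | zero => exact absurd hij (Fin.not_lt_zero _)
      | succ j => simpa using h2 (Fin.succ_lt_succ_iff.1 hij)

theorem term_cons (s : ℕ) (w : List ℕ) (a : ℕ) (f : Fin w.length → ℕ) :
    term (s :: w) (Fin.cons a f : Fin (w.length + 1) → ℕ) = ((a : ℝ) ^ s)⁻¹ * term w f := by
  exact (Fin.prod_univ_succ (n := w.length) _).trans (by simp [term])

/-- Split off the largest index n_1 = m + 1; the remaining indices form a strictly decreasing tuple
bounded by m. -/
theorem sum_term_eq_hsum (w : List ℕ) (N : ℕ) :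
    ∑ n ∈ decreasingUpTo w.length N, term w n = hsum w N := by
  induction w generalizing N with
  | nil =>
    have : decreasingUpTo ([] : List ℕ).length N = (Finset.univ : Finset (Fin 0 → ℕ)) := by
      ext n
      simp only [mem_decreasingUpTo, Finset.mem_univ, iff_true]
      exact ⟨fun i => i.elim0, fun i => i.elim0⟩
    rw [this]
    simp [term]
  | cons s w ih =>
    rw [hsum_cons]
    simp_rw [← ih, Finset.mul_sum]
    rw [Finset.sum_sigma']
    symm
    refine Finset.sum_bij' (fun p _ => (Fin.cons (p.1 + 1) p.2 : Fin (w.length + 1) → ℕ))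
      (fun n _ => ⟨n 0 - 1, Fin.tail n⟩) ?_ ?_ ?_ ?_ ?_
    · rintro ⟨m, f⟩ h
      simp only [Finset.mem_sigma, Finset.mem_range, mem_decreasingUpTo] at h
      refine mem_decreasingUpTo.2 ⟨fun i => ?_, strictAnti_cons.2 ⟨fun i => ?_, h.2.2⟩⟩
      · induction i using Fin.cases with
        | zero => simp; omega
        | succ i => have := h.2.1 i; simp; omega
      · have := h.2.1 i; simp; omega
    · intro n h
      have h' : n ∈ decreasingUpTo (w.length + 1) N := h
      rw [mem_decreasingUpTo] at h'
      have h0 := h'.1 0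
      simp only [Finset.mem_sigma, Finset.mem_range, mem_decreasingUpTo]
      refine ⟨by omega, fun i => ⟨(h'.1 _).1, ?_⟩, fun i j hij => h'.2 (Fin.succ_lt_succ_iff.2 hij)⟩
      have : n i.succ < n 0 := h'.2 (Fin.succ_pos i)
      simp only [Fin.tail]
      omega
    · rintro ⟨m, f⟩ h
      simp
    · intro n h
      have h' : n ∈ decreasingUpTo (w.length + 1) N := h
      have h0 := ((mem_decreasingUpTo.1 h').1 0).1
      have : n 0 - 1 + 1 = n 0 := by omega
      simp only [this]
      exact Fin.cons_self_tail (α := fun _ : Fin (w.length + 1) => ℕ) n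
    · rintro ⟨m, f⟩ h
      exact (term_cons s w (m + 1) f).symm

theorem harmonicSum_eq_hsum (w : List ℕ) : harmonicSum w = hsum w := by
  funext N
  rw [← sum_term_eq_hsum]
  rfl

theorem term_nonneg (w : List ℕ) (n : Fin w.length → ℕ) : 0 ≤ term w n :=
  Finset.prod_nonneg fun _ _ => by positivity

/-- The truncation of the index set `n_1 > ... > n_r > 0` at `n_1 ≤ N`. -/
def decreasingSubtype (r N : ℕ) : Finset (Decreasing r) :=
  (decreasingUpTo r N).subtype fun n => StrictAnti n ∧ ∀ i, 0 < n i

theorem mem_decreasingSubtype {r N : ℕ} {n : Decreasing r} :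
    n ∈ decreasingSubtype r N ↔ ∀ i, n.1 i ≤ N := by
  simp only [decreasingSubtype, Finset.mem_subtype, mem_decreasingUpTo]
  exact ⟨fun h i => (h.1 i).2, fun h => ⟨fun i => ⟨n.2.2 i, h i⟩, n.2.1⟩⟩

theorem sum_decreasingSubtype (w : List ℕ) (N : ℕ) :
    ∑ n ∈ decreasingSubtype w.length N, term w n.1 = hsum w N := by
  rw [← sum_term_eq_hsum, decreasingSubtype]
  refine Finset.sum_subtype_of_mem (term w) fun n hn => ?_
  rw [mem_decreasingUpTo] at hn
  exact ⟨hn.2, fun i => (hn.1 i).1⟩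

theorem decreasingSubtype_mono (r : ℕ) : Monotone (decreasingSubtype r) := fun _ _ h _ hn =>
  mem_decreasingSubtype.2 fun i => (mem_decreasingSubtype.1 hn i).trans h

theorem exists_mem_decreasingSubtype {r : ℕ} (n : Decreasing r) :
    ∃ N, n ∈ decreasingSubtype r N :=
  ⟨∑ i, n.1 i, mem_decreasingSubtype.2 fun i =>
    Finset.single_le_sum (f := n.1) (fun _ _ => Nat.zero_le _) (Finset.mem_univ i)⟩

/-- The terms are nonnegative and the truncations n_1 ≤ N eventually contain any given finite set of
indices, so a bound on the truncated sums bounds all finite sums. -/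
theorem converges_of_hsum_le {w : List ℕ} {B : ℝ} (h : ∀ N, hsum w N ≤ B) : Converges w := by
  refine summable_of_sum_le (c := B) (fun n => term_nonneg w n.1) fun u => ?_
  have : Tendsto (decreasingSubtype w.length) atTop atTop :=
    tendsto_atTop_finset_of_monotone (decreasingSubtype_mono _) exists_mem_decreasingSubtype
  obtain ⟨N, hN⟩ := (this.eventually_ge_atTop u).exists
  exact (Finset.sum_le_sum_of_subset_of_nonneg hN fun n _ _ => term_nonneg w n.1).trans
    ((sum_decreasingSubtype w N).trans_le (h N))

theorem Converges.tendsto_hsum {w : List ℕ} (h : Converges w) :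
    Tendsto (hsum w) atTop (𝓝 (zeta w)) := by
  have h1 : Tendsto (decreasingSubtype w.length) atTop atTop :=
    tendsto_atTop_finset_of_monotone (decreasingSubtype_mono _) exists_mem_decreasingSubtype
  exact (h.hasSum.comp h1).congr fun N => sum_decreasingSubtype w N

theorem converges_of_tendsto_hsum {w : List ℕ} {l : ℝ} (h : Tendsto (hsum w) atTop (𝓝 l)) :
    Converges w :=
  converges_of_hsum_le fun N => (hsum_mono w).ge_of_tendsto h N

theorem zeta_eq_of_tendsto_hsum {w : List ℕ} {l : ℝ} (h : Tendsto (hsum w) atTop (𝓝 l)) :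
    zeta w = l :=
  tendsto_nhds_unique (converges_of_tendsto_hsum h).tendsto_hsum h

theorem gammaReg_eq {w : List ℕ} {c : ℝ} (h : IsFinitePart (hsum w) c) : gammaReg w = c := by
  rw [← harmonicSum_eq_hsum] at h
  have hex : ∃ c, IsFinitePart (harmonicSum w) c := ⟨c, h⟩
  rw [gammaReg, dif_pos hex]
  exact hex.choose_spec.unique h

theorem Converges.isFinitePart {w : List ℕ} (h : Converges w) :
    IsFinitePart (hsum w) (zeta w) := by
  refine ⟨Polynomial.C (zeta w), by simp, ?_⟩
  simpa using h.tendsto_hsum.sub_const (zeta w)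

theorem Converges.gammaReg_eq_zeta {w : List ℕ} (h : Converges w) : gammaReg w = zeta w :=
  gammaReg_eq h.isFinitePart

theorem wordPow_singleton (r k : ℕ) : wordPow [r] k = List.replicate k r := by
  induction k with
  | zero => rfl
  | succ k ih =>
    rw [List.replicate_succ, ← ih]
    rfl

theorem wordPow_succ (w : List ℕ) (k : ℕ) : wordPow w (k + 1) = w ++ wordPow w k := by
  simp [wordPow, List.replicate_succ]

@[simp] theorem wordPow_zero (w : List ℕ) : wordPow w 0 = [] := rfl

/-! ### Power sums and uniform bounds -/

/-- The sum of `j^{-m}` over `1 ≤ j ≤ N`. -/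
def powerSum (m N : ℕ) : ℝ := ∑ j ∈ Finset.range N, (((j + 1 : ℕ) : ℝ) ^ m)⁻¹

theorem powerSum_nonneg (m N : ℕ) : 0 ≤ powerSum m N :=
  Finset.sum_nonneg fun _ _ => by positivity

theorem hsum_cons_le (s : ℕ) (w : List ℕ) (N : ℕ) : hsum (s :: w) N ≤ powerSum s N * hsum w N := by
  rw [hsum_cons, powerSum, Finset.sum_mul]
  refine Finset.sum_le_sum fun m hm => ?_
  exact mul_le_mul_of_nonneg_left (hsum_mono w (Finset.mem_range.1 hm).le) (by positivity)

theorem powerSum_succ (m N : ℕ) :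
    powerSum m (N + 1) = powerSum m N + (((N + 1 : ℕ) : ℝ) ^ m)⁻¹ := by
  rw [powerSum, Finset.sum_range_succ, powerSum]

theorem powerSum_mono (m : ℕ) : Monotone (powerSum m) :=
  monotone_nat_of_le_succ fun N => by
    rw [powerSum_succ]
    exact le_add_of_nonneg_right (by positivity)

/-- Telescoping: (N+2)^{-2} ≤ 1/(N+1) - 1/(N+2). The monotone quantity yields both the uniform bound
2 (its value at N = 0) and the tail estimate 1/n for the convergence to ζ(m). -/
theorem powerSum_add_inv_antitone {m : ℕ} (hm : 2 ≤ m) :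
    Antitone fun N : ℕ => powerSum m (N + 1) + 1 / ((N : ℝ) + 1) := by
  refine antitone_nat_of_succ_le fun N => ?_
  rw [powerSum_succ m (N + 1)]
  have h1 : ((((N + 1 : ℕ) + 1 : ℕ) : ℝ) ^ m)⁻¹ ≤ ((((N + 1 : ℕ) + 1 : ℕ) : ℝ) ^ 2)⁻¹ := by
    gcongr
    · exact_mod_cast Nat.succ_le_succ (Nat.zero_le _)
  have h2 : ((((N + 1 : ℕ) + 1 : ℕ) : ℝ) ^ 2)⁻¹ + 1 / (((N + 1 : ℕ) : ℝ) + 1)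
      ≤ 1 / ((N : ℝ) + 1) := by
    push_cast
    rw [inv_eq_one_div, div_add_div _ _ (by positivity) (by positivity),
      div_le_div_iff₀ (by positivity) (by positivity)]
    have : (0 : ℝ) ≤ N := N.cast_nonneg
    nlinarith [mul_nonneg this this]
  linarith

theorem powerSum_le_two {m : ℕ} (hm : 2 ≤ m) (N : ℕ) : powerSum m N ≤ 2 := by
  have h := powerSum_add_inv_antitone hm (Nat.zero_le N)
  have h1 : powerSum m 1 = 1 := by simp [powerSum]
  have h2 : (0 : ℝ) ≤ 1 / ((N : ℝ) + 1) := by positivity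
  have h3 := powerSum_mono m (Nat.le_succ N)
  simp only [zero_add, h1, Nat.cast_zero] at h
  rw [Nat.succ_eq_add_one] at h3
  linarith

theorem hsum_replicate_le {r : ℕ} (hr : 2 ≤ r) (k N : ℕ) : hsum (List.replicate k r) N ≤ 2 ^ k := by
  induction k with
  | zero => simp
  | succ k ih =>
    rw [List.replicate_succ, pow_succ']
    exact (hsum_cons_le _ _ _).trans
      (mul_le_mul (powerSum_le_two hr N) ih (hsum_nonneg _ _) (by norm_num))

theorem converges_replicate {r : ℕ} (hr : 2 ≤ r) (k : ℕ) : Converges (List.replicate k r) :=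
  converges_of_hsum_le (hsum_replicate_le hr k)


/-! ### Newton's identities for the words {r}^k -/

open PowerSeries in
/-- The generating series of the harmonic sums `H_{{r}^k}(N)`. -/
def hprod (r N : ℕ) : PowerSeries ℝ :=
  ∏ j ∈ Finset.range N, (1 + C (((j + 1 : ℕ) : ℝ) ^ r)⁻¹ * X)

theorem coeff_hprod (r k N : ℕ) :
    PowerSeries.coeff k (hprod r N) = hsum (List.replicate k r) N := by
  induction N generalizing k with
  | zero =>
    cases k with
    | zero => simp [hprod]
    | succ k => simp [hprod, List.replicate_succ, PowerSeries.coeff_one]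
  | succ N ih =>
    rw [hprod, Finset.prod_range_succ, ← hprod, mul_add, mul_one, map_add, ih,
      mul_left_comm, PowerSeries.coeff_C_mul]
    cases k with
    | zero => simp
    | succ k =>
      rw [PowerSeries.coeff_succ_mul_X, ih, List.replicate_succ, hsum_cons_succ]

open PowerSeries in
theorem derivative_hprod (r N : ℕ) :
    derivative ℝ (hprod r N)
      = hprod r N * PowerSeries.mk fun i => (-1) ^ i * powerSum (r * (i + 1)) N := by
  induction N with
  | zero =>
    have : (PowerSeries.mk fun i => (-1) ^ i * powerSum (r * (i + 1)) 0) = (0 : PowerSeries ℝ) := by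
      ext i
      simp [powerSum]
    rw [this]
    simp [hprod]
  | succ N ih =>
    set x : ℝ := (((N + 1 : ℕ) : ℝ) ^ r)⁻¹ with hx
    have h1 : hprod r (N + 1) = hprod r N * (1 + C x * X) := by
      rw [hprod, Finset.prod_range_succ, ← hprod]
    have h2 : (PowerSeries.mk fun i => (-1) ^ i * powerSum (r * (i + 1)) (N + 1))
        = (PowerSeries.mk fun i => (-1) ^ i * powerSum (r * (i + 1)) N)
          + PowerSeries.mk fun i => (-1) ^ i * x ^ (i + 1) := by
      ext i
      rw [map_add, coeff_mk, coeff_mk, coeff_mk, powerSum_succ, hx, pow_mul, inv_pow, mul_add]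
    -- The logarithmic derivative of the new factor 1 + xX is x/(1 + xX), the geometric series Σ
    -- (-1)^i x^{i+1} X^i; stated without a quotient.
    have h3 : (1 + C x * X) * (PowerSeries.mk fun i => (-1) ^ i * x ^ (i + 1)) = C x := by
      ext i
      rw [add_mul, one_mul, map_add, coeff_mk, mul_assoc, coeff_C_mul]
      cases i with
      | zero => simp
      | succ i =>
        rw [coeff_succ_X_mul, coeff_mk, coeff_C, if_neg (by omega)]
        ring
    have h4 : derivative ℝ (1 + C x * X) = C x := by
      simp [Derivation.leibniz]
    rw [h1, h2, Derivation.leibniz, ih, h4, smul_eq_mul, smul_eq_mul]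
    linear_combination -hprod r N * h3

/-- Newton's identities for the harmonic sums `H_{{r}^k}`. -/
theorem succ_mul_hsum_replicate (r k N : ℕ) :
    ((k : ℝ) + 1) * hsum (List.replicate (k + 1) r) N
      = ∑ p ∈ Finset.HasAntidiagonal.antidiagonal k,
        hsum (List.replicate p.1 r) N * ((-1) ^ p.2 * powerSum (r * (p.2 + 1)) N) := by
  have h := congrArg (PowerSeries.coeff k) (derivative_hprod r N)
  rw [PowerSeries.coeff_derivative, PowerSeries.coeff_mul, coeff_hprod] at h
  simp only [coeff_hprod, PowerSeries.coeff_mk] at h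
  rw [← h, mul_comm]

/-! ### Asymptotic expansions in powers of log n -/

/-- `u n = P (log n) + o(log^{-m} n)` for all `m`. -/
def IsLogAsymptotic (u : ℕ → ℝ) (P : Polynomial ℝ) : Prop :=
  ∀ m : ℕ, Tendsto (fun n : ℕ => Real.log n ^ m * (u n - P.eval (Real.log n))) atTop (𝓝 0)

namespace IsLogAsymptotic

theorem isFinitePart {u : ℕ → ℝ} {P : Polynomial ℝ} (h : IsLogAsymptotic u P) :
    IsFinitePart u (P.coeff 0) :=
  ⟨P, rfl, by simpa using h 0⟩

theorem const (c : ℝ) : IsLogAsymptotic (fun _ => c) (Polynomial.C c) := fun m => by simp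

theorem add {u v : ℕ → ℝ} {P Q : Polynomial ℝ} (hu : IsLogAsymptotic u P)
    (hv : IsLogAsymptotic v Q) : IsLogAsymptotic (fun n => u n + v n) (P + Q) := fun m => by
  have := (hu m).add (hv m)
  rw [add_zero] at this
  refine this.congr fun n => ?_
  rw [Polynomial.eval_add]
  ring

theorem polynomial_mul {e : ℕ → ℝ}
    (he : ∀ m : ℕ, Tendsto (fun n : ℕ => Real.log n ^ m * e n) atTop (𝓝 0)) (P : Polynomial ℝ)
    (m : ℕ) : Tendsto (fun n : ℕ => Real.log n ^ m * (P.eval (Real.log n) * e n)) atTop (𝓝 0) := by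
  induction P using Polynomial.induction_on' with
  | add P Q hP hQ =>
    have := hP.add hQ
    rw [add_zero] at this
    refine this.congr fun n => ?_
    rw [Polynomial.eval_add]
    ring
  | monomial i a =>
    have := (he (m + i)).const_mul a
    rw [mul_zero] at this
    refine this.congr fun n => ?_
    rw [Polynomial.eval_monomial]
    ring

/-- The error of a product contains each error times a polynomial in log n. This is why errors are
required to beat every power of log n: a bare o(1) would not be stable under products. -/
theorem mul {u v : ℕ → ℝ} {P Q : Polynomial ℝ} (hu : IsLogAsymptotic u P)
    (hv : IsLogAsymptotic v Q) : IsLogAsymptotic (fun n => u n * v n) (P * Q) := fun m => by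
  have h1 := polynomial_mul hu Q m
  have h2 := polynomial_mul hv P m
  have h3 := (hu m).mul (hv 0)
  have := (h1.add h2).add h3
  rw [mul_zero, add_zero, add_zero] at this
  refine this.congr fun n => ?_
  rw [Polynomial.eval_mul]
  ring

theorem sum {ι : Type*} (s : Finset ι) {u : ι → ℕ → ℝ} {P : ι → Polynomial ℝ}
    (h : ∀ i ∈ s, IsLogAsymptotic (u i) (P i)) :
    IsLogAsymptotic (fun n => ∑ i ∈ s, u i n) (∑ i ∈ s, P i) := by
  classical
  induction s using Finset.induction_on with
  | empty => simpa using const 0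
  | insert i s hi ih =>
    simp only [Finset.sum_insert hi]
    exact (h i (Finset.mem_insert_self i s)).add
      (ih fun j hj => h j (Finset.mem_insert_of_mem hj))

theorem of_le {u : ℕ → ℝ} {P : Polynomial ℝ}
    (h : ∀ n : ℕ, 1 ≤ n → |u n - P.eval (Real.log n)| ≤ 1 / n) : IsLogAsymptotic u P := fun m => by
  have h1 : Tendsto (fun n : ℕ => Real.log n ^ m / n) atTop (𝓝 0) := by
    have := (Real.isLittleO_pow_log_id_atTop (n := m)).tendsto_div_nhds_zero
    exact this.comp tendsto_natCast_atTop_atTop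
  refine squeeze_zero_norm' ?_ h1
  filter_upwards [eventually_ge_atTop 1] with n hn
  have h2 : 0 ≤ Real.log n := Real.log_natCast_nonneg n
  rw [norm_mul, Real.norm_of_nonneg (by positivity), Real.norm_eq_abs, div_eq_mul_one_div]
  exact mul_le_mul_of_nonneg_left (h n hn) (by positivity)

end IsLogAsymptotic

/-- The regularized value at `m ≥ 1` of the zeta series. -/
def sigma (m : ℕ) : ℝ := if m = 1 then Real.eulerMascheroniConstant else zeta [m]

/-- The polynomial in `log n` that the power sums `∑_{j ≤ n} j^{-m}` approach. -/
def powerSumPoly (m : ℕ) : Polynomial ℝ :=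
  if m = 1 then Polynomial.X + Polynomial.C Real.eulerMascheroniConstant
  else Polynomial.C (zeta [m])

theorem powerSumPoly_coeff_zero (m : ℕ) : (powerSumPoly m).coeff 0 = sigma m := by
  unfold powerSumPoly sigma
  split_ifs <;> simp

theorem tendsto_powerSum {m : ℕ} (hm : 2 ≤ m) : Tendsto (powerSum m) atTop (𝓝 (zeta [m])) := by
  refine (converges_replicate hm 1).tendsto_hsum.congr fun N => ?_
  simp [hsum_cons, powerSum]

theorem isLogAsymptotic_powerSum {m : ℕ} (hm : 1 ≤ m) :
    IsLogAsymptotic (powerSum m) (powerSumPoly m) := by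
  refine IsLogAsymptotic.of_le fun n hn => ?_
  rcases hm.eq_or_lt with rfl | hm
  · have h1 : powerSum 1 n = harmonic n := by
      simp [powerSum, harmonic]
    rw [powerSumPoly, if_pos rfl, h1]
    -- The two Euler–Mascheroni sequences enclose γ between H_n - log(n+1) and H_n - log n, so the
    -- error is at most log(n+1) - log n ≤ 1/n.
    have h2 := Real.eulerMascheroniSeq_lt_eulerMascheroniConstant n
    have h3 := Real.eulerMascheroniConstant_lt_eulerMascheroniSeq' n
    rw [Real.eulerMascheroniSeq] at h2
    rw [Real.eulerMascheroniSeq', if_neg (by omega)] at h3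
    have hn' : (0 : ℝ) < n := by exact_mod_cast hn
    have h4 : Real.log (n + 1) - Real.log n ≤ 1 / n := by
      rw [← Real.log_div (by positivity) (by positivity)]
      refine (Real.log_le_sub_one_of_pos (by positivity)).trans (le_of_eq ?_)
      field_simp
      ring
    simp only [Polynomial.eval_add, Polynomial.eval_X, Polynomial.eval_C]
    rw [abs_le]
    constructor <;> linarith
  · rw [powerSumPoly, if_neg (by omega), Polynomial.eval_C]
    have h1 : powerSum m n ≤ zeta [m] := (powerSum_mono m).ge_of_tendsto (tendsto_powerSum hm) n
    have h2 : zeta [m] ≤ powerSum m n + 1 / n := by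
      obtain ⟨N, rfl⟩ := Nat.exists_eq_succ_of_ne_zero (by omega : n ≠ 0)
      refine le_of_tendsto (tendsto_powerSum hm) ?_
      filter_upwards [eventually_ge_atTop (N + 1)] with M hM
      obtain ⟨K, rfl⟩ := Nat.exists_eq_succ_of_ne_zero (by omega : M ≠ 0)
      have := powerSum_add_inv_antitone hm (by omega : N ≤ K)
      have h : (0 : ℝ) ≤ 1 / ((K : ℝ) + 1) := by positivity
      simp only [Nat.succ_eq_add_one] at this ⊢
      push_cast
      linarith
    rw [abs_le]
    constructor <;> linarith

theorem abs_sigma_le_two {m : ℕ} (hm : 1 ≤ m) : |sigma m| ≤ 2 := by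
  unfold sigma
  split_ifs with h
  · have h1 := Real.one_half_lt_eulerMascheroniConstant
    have h2 := Real.eulerMascheroniConstant_lt_two_thirds
    rw [abs_le]
    constructor <;> linarith
  · have hm : 2 ≤ m := by omega
    rw [abs_of_nonneg (ge_of_tendsto' (tendsto_powerSum hm) (powerSum_nonneg m))]
    exact le_of_tendsto' (tendsto_powerSum hm) (powerSum_le_two hm)

/-! ### Finite parts for the words {r}^k -/

theorem exists_isLogAsymptotic {r : ℕ} (hr : 1 ≤ r) (k : ℕ) :
    ∃ P, IsLogAsymptotic (hsum (List.replicate k r)) P := by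
  induction k using Nat.strong_induction_on with
  | _ k ih =>
    cases k with
    | zero => exact ⟨_, IsLogAsymptotic.const 1⟩
    | succ k =>
      choose! P hP using ih
      have h := (IsLogAsymptotic.const ((k : ℝ) + 1)⁻¹).mul
        (IsLogAsymptotic.sum (Finset.HasAntidiagonal.antidiagonal k) fun p hp =>
          (hP p.1 (Nat.lt_succ_of_le (Finset.HasAntidiagonal.antidiagonal.fst_le hp))).mul
            ((IsLogAsymptotic.const ((-1) ^ p.2)).mul
              (isLogAsymptotic_powerSum (m := r * (p.2 + 1)) (Nat.mul_pos hr p.2.succ_pos))))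
      have e : (fun N => ((k : ℝ) + 1)⁻¹ * ∑ p ∈ Finset.HasAntidiagonal.antidiagonal k,
          hsum (List.replicate p.1 r) N * ((-1) ^ p.2 * powerSum (r * (p.2 + 1)) N))
          = hsum (List.replicate (k + 1) r) := by
        funext N
        rw [← succ_mul_hsum_replicate]
        field_simp
      rw [e] at h
      exact ⟨_, h⟩

theorem isFinitePart_gammaReg {r : ℕ} (hr : 1 ≤ r) (k : ℕ) :
    IsFinitePart (hsum (List.replicate k r)) (gammaReg (List.replicate k r)) := by
  obtain ⟨P, hP⟩ := exists_isLogAsymptotic hr k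
  rw [gammaReg_eq hP.isFinitePart]
  exact hP.isFinitePart

theorem gammaReg_nil : gammaReg [] = 1 :=
  gammaReg_eq (by
    have h := (IsLogAsymptotic.const 1).isFinitePart
    rw [Polynomial.coeff_C_zero] at h
    exact h)

/-- Both sides of Newton's identity have log-polynomial expansions, and the constant term is
multiplicative on polynomials, so uniqueness of the finite part transfers the identity. -/
theorem succ_mul_gammaReg {r : ℕ} (hr : 1 ≤ r) (k : ℕ) :
    ((k : ℝ) + 1) * gammaReg (List.replicate (k + 1) r)
      = ∑ p ∈ Finset.HasAntidiagonal.antidiagonal k,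
        gammaReg (List.replicate p.1 r) * ((-1) ^ p.2 * sigma (r * (p.2 + 1))) := by
  choose P hP using exists_isLogAsymptotic hr
  have hc : ∀ k, gammaReg (List.replicate k r) = (P k).coeff 0 := fun k =>
    gammaReg_eq (hP k).isFinitePart
  have h := (IsLogAsymptotic.sum (Finset.HasAntidiagonal.antidiagonal k) fun p _ =>
    (hP p.1).mul ((IsLogAsymptotic.const ((-1) ^ p.2)).mul
      (isLogAsymptotic_powerSum (m := r * (p.2 + 1)) (Nat.mul_pos hr p.2.succ_pos)))).isFinitePart
  have h' := ((IsLogAsymptotic.const ((k : ℝ) + 1)).mul (hP (k + 1))).isFinitePart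
  simp only [succ_mul_hsum_replicate] at h'
  have := h'.unique h
  simpa only [hc, Polynomial.finsetSum_coeff, Polynomial.mul_coeff_zero, Polynomial.coeff_C_zero,
    powerSumPoly_coeff_zero]
    using this

/-- The recurrence with |σ| ≤ 2 propagates the bound, because Σ_{i ≤ k} 2(i+1) = (k+1)(k+2). Linear
growth is all that convergence on the open unit disc needs, and it covers r = 1 as well. -/
theorem abs_gammaReg_le {r : ℕ} (hr : 1 ≤ r) (k : ℕ) :
    |gammaReg (List.replicate k r)| ≤ k + 1 := by
  induction k using Nat.strong_induction_on with
  | _ k ih =>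
    cases k with
    | zero => simp [gammaReg_nil]
    | succ k =>
      have h1 : ((k : ℝ) + 1) * |gammaReg (List.replicate (k + 1) r)|
          ≤ ∑ p ∈ Finset.HasAntidiagonal.antidiagonal k, ((p.1 : ℝ) + 1) * 2 := by
        rw [← abs_of_nonneg (by positivity : (0 : ℝ) ≤ (k : ℝ) + 1), ← abs_mul,
          succ_mul_gammaReg hr]
        refine (Finset.abs_sum_le_sum_abs _ _).trans (Finset.sum_le_sum fun p hp => ?_)
        rw [abs_mul, abs_mul, abs_pow, abs_neg, abs_one, one_pow, one_mul]
        exact mul_le_mul (ih p.1 (Nat.lt_succ_of_le (Finset.HasAntidiagonal.antidiagonal.fst_le hp)))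
          (abs_sigma_le_two (Nat.mul_pos hr p.2.succ_pos)) (abs_nonneg _) (by positivity)
      have h2 : ∑ p ∈ Finset.HasAntidiagonal.antidiagonal k, ((p.1 : ℝ) + 1) * 2 = (k + 1) * (k + 2) := by
        rw [Finset.Nat.sum_antidiagonal_eq_sum_range_succ_mk]
        clear ih h1
        induction k with
        | zero => norm_num
        | succ k ih =>
          rw [Finset.sum_range_succ, ih]
          push_cast
          ring
      rw [h2] at h1
      have := le_of_mul_le_mul_left h1 (by positivity)
      push_cast
      linarith


/-! ### Newton's recurrence as a differential equation -/

theorem summable_norm_mul_pow {a : ℕ → ℂ} {z : ℂ} (ha : ∀ k, ‖a k‖ ≤ k + 2) (hz : ‖z‖ < 1) :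
    Summable fun k => ‖a k * z ^ k‖ := by
  have h1 := summable_norm_pow_mul_geometric_of_norm_lt_one 1 hz
  have h2 := (summable_geometric_of_lt_one (norm_nonneg z) hz).mul_left 2
  refine (h1.add h2).of_nonneg_of_le (fun _ => norm_nonneg _) fun k => ?_
  have : ‖((k : ℂ) ^ 1 * z ^ k : ℂ)‖ + 2 * ‖z‖ ^ k = (k + 2) * ‖z‖ ^ k := by
    rw [norm_mul, norm_pow, norm_pow, pow_one, Complex.norm_natCast]
    ring
  rw [this, norm_mul, norm_pow]
  exact mul_le_mul_of_nonneg_right (ha k) (by positivity)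

theorem hasDerivAt_tsum_pow {a : ℕ → ℂ} {z : ℂ} (ha : ∀ k, ‖a k‖ ≤ k + 1) (hz : ‖z‖ < 1) :
    HasDerivAt (fun z => ∑' k, a k * z ^ k) (∑' k, ((k + 1 : ℕ) : ℂ) * a (k + 1) * z ^ k) z := by
  obtain ⟨ρ, h1, h2⟩ := exists_between hz
  have hρ : 0 ≤ ρ := (norm_nonneg z).trans h1.le
  have hu : Summable fun k : ℕ => ((k : ℝ) * (k + 1)) * ρ ^ (k - 1) := by
    rw [← summable_nat_add_iff 1]
    have hρ' : ‖ρ‖ < 1 := by rwa [Real.norm_of_nonneg hρ]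
    have e1 := summable_pow_mul_geometric_of_norm_lt_one 2 hρ'
    have e2 := (summable_pow_mul_geometric_of_norm_lt_one 1 hρ').mul_left 3
    have e3 := (summable_pow_mul_geometric_of_norm_lt_one 0 hρ').mul_left 2
    refine ((e1.add e2).add e3).congr fun k => ?_
    push_cast [Nat.add_sub_cancel]
    ring
  have hbound : ∀ (k : ℕ) (y : ℂ), y ∈ Metric.ball (0 : ℂ) ρ →
      ‖a k * (k * y ^ (k - 1))‖ ≤ (k : ℝ) * (k + 1) * ρ ^ (k - 1) := fun k y hy => by
    have hy' : ‖y‖ ≤ ρ := by simpa using (Metric.mem_ball.1 hy).le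
    rw [norm_mul, norm_mul, norm_pow, Complex.norm_natCast]
    calc ‖a k‖ * (k * ‖y‖ ^ (k - 1)) ≤ (k + 1) * (k * ρ ^ (k - 1)) := by
          gcongr
          exact ha k
      _ = k * (k + 1) * ρ ^ (k - 1) := by ring
  have hzρ : z ∈ Metric.ball (0 : ℂ) ρ := by simpa using h1
  have key := hasDerivAt_tsum_of_isPreconnected (g := fun k z => a k * z ^ k)
    (g' := fun k z => a k * (k * z ^ (k - 1))) (t := Metric.ball 0 ρ) (y₀ := 0) (y := z) hu
    Metric.isOpen_ball (convex_ball 0 ρ).isPreconnected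
    (fun k y _ => (hasDerivAt_pow k y).const_mul (a k)) hbound
    (by simpa using (norm_nonneg z).trans_lt h1)
    (summable_norm_mul_pow (fun k => (ha k).trans (by linarith)) (by simp)).of_norm hzρ
  refine key.congr_deriv ?_
  rw [(Summable.of_norm_bounded hu fun k => hbound k z hzρ).tsum_eq_zero_add]
  simp only [Nat.cast_zero, zero_mul, mul_zero, zero_add, Nat.add_sub_cancel]
  exact tsum_congr fun k => by ring

/-- A power series whose coefficients satisfy Newton's recurrence is an exponential. -/
theorem hasSum_exp_of_recurrence {a s : ℕ → ℂ} (ha0 : a 0 = 1) (ha : ∀ k, ‖a k‖ ≤ k + 1)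
    (hs : ∀ k, ‖s k‖ ≤ 2)
    (h : ∀ k : ℕ, ((k + 1 : ℕ) : ℂ) * a (k + 1)
      = ∑ p ∈ Finset.HasAntidiagonal.antidiagonal k, a p.1 * s p.2)
    {z : ℂ} (hz : ‖z‖ < 1) :
    HasSum (fun k => a k * z ^ k)
      (Complex.exp (∑' k : ℕ, s k * z ^ (k + 1) / ((k + 1 : ℕ) : ℂ))) := by
  set F : ℂ → ℂ := fun z => ∑' k, a k * z ^ k with hF
  -- Coefficients of the primitive G, vanishing at 0, of Σ s_k z^k.
  set b : ℕ → ℂ := fun k => if k = 0 then 0 else s (k - 1) / k with hb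
  have hb1 : ∀ k, ‖b k‖ ≤ k + 1 := by
    intro k
    rcases k with _ | k
    · simp [hb]
    · simp only [hb, Nat.succ_ne_zero, if_false, Nat.add_sub_cancel]
      rw [norm_div, Complex.norm_natCast, div_le_iff₀ (by positivity)]
      refine (hs k).trans ?_
      push_cast
      nlinarith [(Nat.cast_nonneg k : (0 : ℝ) ≤ k)]
  set G : ℂ → ℂ := fun z => ∑' k, b k * z ^ k with hG
  have hG' : ∀ z : ℂ, ‖z‖ < 1 → HasDerivAt G (∑' k, s k * z ^ k) z := fun z hz => by
    refine (hasDerivAt_tsum_pow hb1 hz).congr_deriv ?_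
    refine tsum_congr fun k => ?_
    have : ((k + 1 : ℕ) : ℂ) ≠ 0 := Nat.cast_ne_zero.2 k.succ_ne_zero
    simp only [hb, Nat.succ_ne_zero, if_false, Nat.add_sub_cancel]
    field_simp
  -- The recurrence is the Cauchy product form of F' = F · Σ s_k z^k. Hence F · exp(-G) has zero
  -- derivative on the unit disc and equals its value 1 at the origin.
  have hF' : ∀ z : ℂ, ‖z‖ < 1 → HasDerivAt F (F z * ∑' k, s k * z ^ k) z := fun z hz => by
    refine (hasDerivAt_tsum_pow ha hz).congr_deriv ?_
    rw [hF]
    simp only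
    rw [tsum_mul_tsum_eq_tsum_sum_antidiagonal_of_summable_norm
      (summable_norm_mul_pow (fun k => (ha k).trans (by linarith)) hz)
      (summable_norm_mul_pow (fun k => (hs k).trans (by linarith [(Nat.cast_nonneg k : (0 : ℝ) ≤ k)])) hz)]
    refine tsum_congr fun k => ?_
    rw [h, Finset.sum_mul]
    refine Finset.sum_congr rfl fun p hp => ?_
    rw [← Finset.HasAntidiagonal.mem_antidiagonal.1 hp, pow_add]
    ring
  have hD : ∀ z : ℂ, ‖z‖ < 1 → HasDerivAt (fun z => F z * Complex.exp (-G z)) 0 z := fun z hz => by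
    refine ((hF' z hz).mul (hG' z hz).neg.cexp).congr_deriv ?_
    ring
  have hconst : F z * Complex.exp (-G z) = F 0 * Complex.exp (-G 0) := by
    refine Metric.isOpen_ball.is_const_of_deriv_eq_zero (s := Metric.ball (0 : ℂ) 1)
      (convex_ball (0 : ℂ) 1).isPreconnected (f := fun z => F z * Complex.exp (-G z))
      (fun w hw => ?_) (fun w hw => ?_) ?_ ?_
    · exact (hD w (by simpa using hw)).differentiableAt.differentiableWithinAt
    · exact (hD w (by simpa using hw)).deriv
    · simpa using hz
    · simp
  have hF0 : F 0 = 1 := by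
    rw [hF]
    simp only
    rw [tsum_eq_single 0 (fun k hk => by simp [hk])]
    simp [ha0]
  have hG0 : G 0 = 0 := by
    rw [hG]
    simp only
    rw [tsum_eq_single 0 (fun k hk => by simp [hk])]
    simp [hb]
  have hsa := (summable_norm_mul_pow (fun k => (ha k).trans (by linarith)) hz).of_norm
  have hsb := (summable_norm_mul_pow (fun k => (hb1 k).trans (by linarith)) hz).of_norm
  have hGz : G z = ∑' k : ℕ, s k * z ^ (k + 1) / ((k + 1 : ℕ) : ℂ) := by
    rw [hG]
    simp only
    rw [hsb.tsum_eq_zero_add]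
    simp only [hb, Nat.succ_ne_zero, if_false, if_true, zero_mul, zero_add, Nat.add_sub_cancel]
    exact tsum_congr fun k => by ring
  rw [hF0, hG0, neg_zero, Complex.exp_zero, mul_one, Complex.exp_neg] at hconst
  rw [← hGz, ← eq_of_mul_inv_eq_one hconst]
  exact hsa.hasSum

/-! ### Generating series of the finite parts and the functions ℓ_r -/

theorem hasSum_gammaReg {r : ℕ} (hr : 1 ≤ r) {c : ℂ} (hc : ‖c‖ < 1) :
    HasSum (fun k : ℕ => c ^ k * (gammaReg (wordPow [r] k) : ℂ))
      (Complex.exp (∑' k : ℕ, (-1) ^ k * (sigma (r * (k + 1)) : ℂ) * c ^ (k + 1)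
        / ((k + 1 : ℕ) : ℂ))) := by
  have := hasSum_exp_of_recurrence (a := fun k => (gammaReg (List.replicate k r) : ℂ))
    (s := fun k => (-1) ^ k * (sigma (r * (k + 1)) : ℂ)) (by simp [gammaReg_nil])
    (fun k => ?_) (fun k => ?_) (fun k => ?_) hc
  · convert this using 2 with k
    rw [wordPow_singleton, mul_comm]
  · simpa using abs_gammaReg_le hr k
  · simpa using abs_sigma_le_two (Nat.mul_pos hr k.succ_pos)
  · have := succ_mul_gammaReg hr k
    exact_mod_cast this

theorem sigma_eq_riemannZeta {m : ℕ} (hm : 2 ≤ m) : (sigma m : ℂ) = riemannZeta m := by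
  rw [sigma, if_neg (by omega), zeta_nat_eq_tsum_of_gt_one (by omega)]
  have h1 : Summable fun n : ℕ => 1 / (n : ℝ) ^ m := Real.summable_one_div_nat_pow.2 (by omega)
  have h2 : Tendsto (powerSum m) atTop (𝓝 (∑' n : ℕ, 1 / (n : ℝ) ^ m)) := by
    rw [h1.tsum_eq_zero_add]
    have := ((summable_nat_add_iff 1).2 h1).hasSum.tendsto_sum_nat
    have h0 : 1 / ((0 : ℕ) : ℝ) ^ m = 0 := by
      rw [Nat.cast_zero, zero_pow (by omega), div_zero]
    rw [h0, zero_add]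
    refine this.congr fun N => ?_
    simp [powerSum]
  rw [tendsto_nhds_unique (tendsto_powerSum hm) h2]
  push_cast
  rfl

theorem summable_sigma_mul {r : ℕ} (hr : 1 ≤ r) {c : ℂ} (hc : ‖c‖ < 1) :
    Summable fun k : ℕ => (-1) ^ k * (sigma (r * (k + 1)) : ℂ) * c ^ (k + 1)
      / ((k + 1 : ℕ) : ℂ) := by
  have h := ((summable_norm_mul_pow (a := fun k => (-1) ^ k * (sigma (r * (k + 1)) : ℂ)
      / ((k + 1 : ℕ) : ℂ)) (z := c) (fun k => ?_) hc).of_norm).mul_left c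
  · refine h.congr fun k => ?_
    ring
  · rw [norm_div, Complex.norm_natCast, div_le_iff₀ (by positivity)]
    have := abs_sigma_le_two (m := r * (k + 1)) (Nat.mul_pos hr k.succ_pos)
    simp only [norm_mul, norm_pow, norm_neg, norm_one, one_pow, one_mul, Complex.norm_real,
      Real.norm_eq_abs]
    push_cast
    nlinarith [(Nat.cast_nonneg k : (0 : ℝ) ≤ k)]

/-- The functions `ℓ_r` in terms of the regularized zeta values. -/
theorem ell_eq {r : ℕ} (hr : 1 ≤ r) {z : ℂ} (hz : ‖z‖ < 1) :
    ell r z = ∑' k : ℕ, (-1) ^ k * (sigma (r * (k + 1)) : ℂ) * (z ^ r) ^ (k + 1)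
      / ((k + 1 : ℕ) : ℂ) := by
  unfold ell
  split_ifs with h
  · subst h
    simp only [one_mul, pow_one]
    have hs := summable_sigma_mul le_rfl hz
    simp only [one_mul] at hs
    -- For r = 1 the index-zero term is γz, since `sigma 1` is γ; this absorbs the separate linear
    -- term of ℓ_1.
    rw [hs.tsum_eq_zero_add, ← sub_neg_eq_add, ← tsum_neg]
    congr 1
    · simp [sigma]
    · refine tsum_congr fun k => ?_
      rw [sigma_eq_riemannZeta (by omega), neg_pow z]
      ring_nf
  · rw [← tsum_neg]
    refine tsum_congr fun k => ?_
    rw [sigma_eq_riemannZeta (by nlinarith [Nat.zero_le k, (by omega : 2 ≤ r)]), mul_comm (k + 1) r,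
      neg_pow (z ^ r)]
    ring

theorem hasSum_gammaReg_ell {r : ℕ} (hr : 1 ≤ r) {z : ℂ} (hz : ‖z‖ < 1) :
    HasSum (fun k : ℕ => (z ^ r) ^ k * (gammaReg (wordPow [r] k) : ℂ)) (GammaY r (1 + z))⁻¹ := by
  have hzr : ‖z ^ r‖ < 1 := by
    rw [norm_pow]
    exact pow_lt_one₀ (norm_nonneg z) hz (by omega)
  rw [GammaY, add_sub_cancel_left, ← Complex.exp_neg, neg_neg, ell_eq hr hz]
  exact hasSum_gammaReg hr hzr


/-! ### Infinite products, sine functions and the values ζ({2}^k), ζ({4}^k) -/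

theorem hasSum_prod_one_add (r N : ℕ) (c : ℂ) :
    HasSum (fun k : ℕ => c ^ k * (hsum (List.replicate k r) N : ℂ))
      (∏ j ∈ Finset.range N, (1 + c * (((j + 1 : ℕ) : ℂ) ^ r)⁻¹)) := by
  induction N with
  | zero =>
    convert! hasSum_ite_eq (0 : ℕ) (1 : ℂ) using 1
    funext k
    cases k with
    | zero => simp
    | succ k => simp [List.replicate_succ]
  | succ N ih =>
    rw [Finset.prod_range_succ]
    set P := ∏ j ∈ Finset.range N, (1 + c * (((j + 1 : ℕ) : ℂ) ^ r)⁻¹)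
    rw [← hasSum_nat_add_iff' 1]
    have h1 := (hasSum_nat_add_iff' 1).2 ih
    have h2 := ih.mul_left (c * (((N + 1 : ℕ) : ℂ) ^ r)⁻¹)
    have h3 := h1.add h2
    simp only [Finset.range_one, Finset.sum_singleton, List.replicate_zero, hsum_nil, pow_zero,
      Complex.ofReal_one, mul_one] at h3 ⊢
    have e : P - 1 + c * (((N + 1 : ℕ) : ℂ) ^ r)⁻¹ * P
        = P * (1 + c * (((N + 1 : ℕ) : ℂ) ^ r)⁻¹) - 1 := by ring
    rw [← e]
    refine h3.congr_fun fun k => ?_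
    rw [List.replicate_succ, hsum_cons_succ]
    push_cast
    ring

theorem summable_norm_mul_zeta_replicate {r : ℕ} (hr : 2 ≤ r) {c : ℂ} (hc : ‖c‖ < 1 / 2) :
    Summable fun k : ℕ => ‖c ^ k * (zeta (List.replicate k r) : ℂ)‖ := by
  have h : Summable fun k : ℕ => (2 * ‖c‖) ^ k :=
    summable_geometric_of_lt_one (by positivity) (by linarith)
  refine h.of_nonneg_of_le (fun _ => norm_nonneg _) fun k => ?_
  have h1 := (converges_replicate hr k).tendsto_hsum
  rw [norm_mul, norm_pow, mul_pow, mul_comm, Complex.norm_real,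
    Real.norm_of_nonneg (ge_of_tendsto' h1 fun N => hsum_nonneg _ N)]
  exact mul_le_mul_of_nonneg_right (le_of_tendsto' h1 (hsum_replicate_le hr k)) (by positivity)

/-- The infinite product `∏ (1 + c / j ^ r)` is the generating series of the `ζ({r}^k)`. -/
theorem tendsto_prod_one_add {r : ℕ} (hr : 2 ≤ r) {c : ℂ} (hc : ‖c‖ < 1 / 2) :
    Tendsto (fun N => ∏ j ∈ Finset.range N, (1 + c * (((j + 1 : ℕ) : ℂ) ^ r)⁻¹)) atTop
      (𝓝 (∑' k : ℕ, c ^ k * (zeta (List.replicate k r) : ℂ))) := by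
  have h : Summable fun k : ℕ => (2 * ‖c‖) ^ k :=
    summable_geometric_of_lt_one (by positivity) (by linarith)
  -- The bound 2^k on the harmonic sums gives the dominating series (2‖c‖)^k, hence the restriction
  -- ‖c‖ < 1/2. A small disc suffices to identify coefficients.
  have := tendsto_tsum_of_dominated_convergence (𝓕 := atTop)
    (f := fun N k => c ^ k * (hsum (List.replicate k r) N : ℂ))
    (g := fun k => c ^ k * (zeta (List.replicate k r) : ℂ)) h (fun k => ?_)
    (Eventually.of_forall fun N k => ?_)
  · exact this.congr fun N => (hasSum_prod_one_add r N c).tsum_eq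
  · exact ((Complex.continuous_ofReal.tendsto _).comp
      (converges_replicate hr k).tendsto_hsum).const_mul _
  · rw [norm_mul, norm_pow, mul_pow, mul_comm, Complex.norm_real,
      Real.norm_of_nonneg (hsum_nonneg _ N)]
    exact mul_le_mul_of_nonneg_right (hsum_replicate_le hr k N) (by positivity)

theorem eq_of_hasSum_pow {a b : ℕ → ℂ} {f : ℂ → ℂ} {ρ : ℝ} (hρ : 0 < ρ)
    (ha : ∀ x : ℂ, ‖x‖ < ρ → HasSum (fun k => x ^ k * a k) (f x))
    (hb : ∀ x : ℂ, ‖x‖ < ρ → HasSum (fun k => x ^ k * b k) (f x)) : a = b := by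
  have key : ∀ {a : ℕ → ℂ}, (∀ x : ℂ, ‖x‖ < ρ → HasSum (fun k => x ^ k * a k) (f x)) →
      HasFPowerSeriesAt f (FormalMultilinearSeries.ofScalars ℂ a) 0 := fun {a} h => by
    rw [hasFPowerSeriesAt_iff]
    filter_upwards [Metric.ball_mem_nhds (0 : ℂ) hρ] with x hx
    simpa using h x (by simpa using hx)
  have := (key ha).eq_formalMultilinearSeries (key hb)
  funext k
  simpa using congrArg (fun p => FormalMultilinearSeries.coeff p k) this

/-- The entire function `sin w / w`. -/
def csinc (w : ℂ) : ℂ := if w = 0 then 1 else Complex.sin w / w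

theorem csinc_of_ne_zero {w : ℂ} (hw : w ≠ 0) : csinc w = Complex.sin w / w := if_neg hw

theorem hasSum_csinc (w : ℂ) :
    HasSum (fun k : ℕ => (-w ^ 2) ^ k / ((2 * k + 1).factorial : ℂ)) (csinc w) := by
  unfold csinc
  split_ifs with hw
  · subst hw
    convert! hasSum_ite_eq (0 : ℕ) (1 : ℂ) using 1
    funext k
    cases k with
    | zero => simp
    | succ k => simp
  · refine ((Complex.hasSum_sin w).div_const w).congr_fun fun k => ?_
    rw [neg_pow, ← pow_mul, pow_succ]
    field_simp

/-- Use 2 sin w sin(iw) = cos((1-i)w) - cos((1+i)w). Since (1-i)^4 = (1+i)^4 = -4, the terms of even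
index in the two cosine series cancel, while those of odd index 2k+1 add up, because (1∓i)^2 = ∓2i.
-/
theorem hasSum_csinc_mul_csinc (w : ℂ) :
    HasSum (fun k : ℕ => 2 * (-4) ^ k * w ^ (4 * k) / ((4 * k + 2).factorial : ℂ))
      (csinc w * csinc (Complex.I * w)) := by
  by_cases hw : w = 0
  · subst hw
    have : csinc 0 = 1 := if_pos rfl
    rw [mul_zero, this, one_mul]
    convert! hasSum_ite_eq (0 : ℕ) (1 : ℂ) using 1
    funext k
    cases k with
    | zero => simp
    | succ k => simp
  rw [csinc_of_ne_zero hw, csinc_of_ne_zero (mul_ne_zero Complex.I_ne_zero hw)]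
  have h1 := Complex.hasSum_cos (w - Complex.I * w)
  have h2 := Complex.hasSum_cos (w + Complex.I * w)
  have h3 := (h1.sub h2).div_const (2 * (w * (Complex.I * w)))
  have e : (Complex.cos (w - Complex.I * w) - Complex.cos (w + Complex.I * w))
      / (2 * (w * (Complex.I * w)))
      = Complex.sin w / w * (Complex.sin (Complex.I * w) / (Complex.I * w)) := by
    rw [Complex.cos_sub, Complex.cos_add]
    field_simp
    ring
  rw [e] at h3
  have hinj : Function.Injective fun k : ℕ => 2 * k + 1 := fun a b h => by
    simp only at h
    omega
  rw [← hinj.hasSum_iff] at h3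
  · refine h3.congr_fun fun k => ?_
    have hI := Complex.I_sq
    have s1 : (w - Complex.I * w) ^ (2 * (2 * k + 1)) = (-4) ^ k * w ^ (4 * k) * (-2 * Complex.I * w ^ 2) := by
      have q : (w - Complex.I * w) ^ 2 = -2 * Complex.I * w ^ 2 := by
        linear_combination w ^ 2 * hI
      rw [pow_mul, q, pow_succ, pow_mul, pow_mul, ← mul_pow]
      congr 2
      linear_combination 4 * w ^ 4 * hI
    have s2 : (w + Complex.I * w) ^ (2 * (2 * k + 1)) = (-4) ^ k * w ^ (4 * k) * (2 * Complex.I * w ^ 2) := by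
      have q : (w + Complex.I * w) ^ 2 = 2 * Complex.I * w ^ 2 := by
        linear_combination w ^ 2 * hI
      rw [pow_mul, q, pow_succ, pow_mul, pow_mul, ← mul_pow]
      congr 2
      linear_combination 4 * w ^ 4 * hI
    have s3 : ((-1 : ℂ)) ^ (2 * k + 1) = -1 := by rw [pow_succ, pow_mul]; simp
    simp only [Function.comp]
    rw [s1, s2, s3, show 2 * (2 * k + 1) = 4 * k + 2 by ring]
    have : ((4 * k + 2).factorial : ℂ) ≠ 0 := Nat.cast_ne_zero.2 (Nat.factorial_ne_zero _)
    have := Complex.I_ne_zero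
    field_simp
    ring
  · intro m hm
    obtain ⟨k, rfl⟩ : ∃ k, m = 2 * k := by
      rcases Nat.even_or_odd' m with ⟨k, h | h⟩
      · exact ⟨k, h⟩
      · exact absurd ⟨k, h.symm⟩ hm
    have q : (w - Complex.I * w) ^ (2 * (2 * k)) = (w + Complex.I * w) ^ (2 * (2 * k)) := by
      have hI := Complex.I_sq
      rw [show 2 * (2 * k) = 4 * k by ring, pow_mul, pow_mul]
      congr 1
      linear_combination (-8 * Complex.I * w ^ 4) * hI
    rw [q, sub_self, zero_div]

theorem tendsto_prod_csinc (t : ℂ) :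
    Tendsto (fun N => ∏ j ∈ Finset.range N, (1 + (-t ^ 2) * (((j + 1 : ℕ) : ℂ) ^ 2)⁻¹)) atTop
      (𝓝 (csinc (Real.pi * t))) := by
  by_cases ht : t = 0
  · subst ht
    simp [csinc]
  have hw : (Real.pi : ℂ) * t ≠ 0 :=
    mul_ne_zero (Complex.ofReal_ne_zero.2 Real.pi_ne_zero) ht
  rw [csinc_of_ne_zero hw]
  refine ((Complex.tendsto_euler_sin_prod t).div_const (Real.pi * t)).congr fun N => ?_
  rw [mul_div_assoc, mul_comm, div_mul_cancel₀ _ hw]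
  refine Finset.prod_congr rfl fun j _ => ?_
  push_cast
  ring

theorem zeta_replicate_two (k : ℕ) :
    zeta (List.replicate k 2) = Real.pi ^ (2 * k) / ((2 * k + 1).factorial : ℝ) := by
  have h : (fun k : ℕ => (zeta (List.replicate k 2) : ℂ))
      = fun k : ℕ => (Real.pi : ℂ) ^ (2 * k) / ((2 * k + 1).factorial : ℂ) := by
    refine eq_of_hasSum_pow (f := fun x => ∑' k : ℕ, x ^ k * (zeta (List.replicate k 2) : ℂ))
      (by norm_num : (0 : ℝ) < 1 / 2)
      (fun x hx => (summable_norm_mul_zeta_replicate le_rfl hx).of_norm.hasSum) fun x hx => ?_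
    -- Every x is some -t^2, so the sine product covers a full disc in x.
    obtain ⟨t, ht⟩ := IsAlgClosed.exists_pow_nat_eq (-x) (by norm_num : 0 < 2)
    obtain rfl : x = -t ^ 2 := by rw [ht, neg_neg]
    rw [tendsto_nhds_unique (tendsto_prod_one_add le_rfl hx) (tendsto_prod_csinc t)]
    refine (hasSum_csinc (Real.pi * t)).congr_fun fun k => ?_
    rw [mul_pow, pow_mul, ← mul_neg, mul_pow]
    ring
  have := congrFun h k
  exact_mod_cast this

theorem tendsto_prod_csinc_mul_csinc (t : ℂ) :
    Tendsto (fun N => ∏ j ∈ Finset.range N, (1 + (-t ^ 4) * (((j + 1 : ℕ) : ℂ) ^ 4)⁻¹)) atTop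
      (𝓝 (csinc (Real.pi * t) * csinc (Complex.I * (Real.pi * t)))) := by
  have h1 := (tendsto_prod_csinc t).mul (tendsto_prod_csinc (Complex.I * t))
  rw [mul_left_comm (Real.pi : ℂ) Complex.I t] at h1
  refine h1.congr fun N => ?_
  rw [← Finset.prod_mul_distrib]
  refine Finset.prod_congr rfl fun j _ => ?_
  rw [mul_pow, Complex.I_sq]
  ring

theorem zeta_replicate_four (k : ℕ) :
    zeta (List.replicate k 4) = 4 ^ k * (2 * Real.pi ^ (4 * k) / ((4 * k + 2).factorial : ℝ)) := by
  have h : (fun k : ℕ => (zeta (List.replicate k 4) : ℂ))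
      = fun k : ℕ => 4 ^ k * (2 * (Real.pi : ℂ) ^ (4 * k) / ((4 * k + 2).factorial : ℂ)) := by
    refine eq_of_hasSum_pow (f := fun x => ∑' k : ℕ, x ^ k * (zeta (List.replicate k 4) : ℂ))
      (by norm_num : (0 : ℝ) < 1 / 2)
      (fun x hx => (summable_norm_mul_zeta_replicate (by norm_num) hx).of_norm.hasSum)
      fun x hx => ?_
    obtain ⟨t, ht⟩ := IsAlgClosed.exists_pow_nat_eq (-x) (by norm_num : 0 < 4)
    obtain rfl : x = -t ^ 4 := by rw [ht, neg_neg]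
    rw [tendsto_nhds_unique (tendsto_prod_one_add (by norm_num) hx)
      (tendsto_prod_csinc_mul_csinc t)]
    refine (hasSum_csinc_mul_csinc (Real.pi * t)).congr_fun fun k => ?_
    rw [neg_pow (t ^ 4), neg_pow 4, mul_pow]
    ring
  have := congrFun h k
  exact_mod_cast this

/-- The alternating convolutions of the values `ζ({2}^k)`. -/
theorem sum_zeta_two_mul_zeta_two (n : ℕ) :
    ∑ p ∈ Finset.HasAntidiagonal.antidiagonal (2 * n),
        zeta (List.replicate p.1 2) * ((-1) ^ p.2 * zeta (List.replicate p.2 2))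
      = (-4) ^ n * (2 * Real.pi ^ (4 * n) / ((4 * n + 2).factorial : ℝ)) := by
  set d : ℕ → ℂ := fun m => if Even m then
    (-4) ^ (m / 2) * (2 * (Real.pi : ℂ) ^ (4 * (m / 2)) / ((4 * (m / 2) + 2).factorial : ℂ)) else 0
    with hd
  have h : (fun m : ℕ => ∑ p ∈ Finset.HasAntidiagonal.antidiagonal m,
      (zeta (List.replicate p.1 2) : ℂ) * ((-1) ^ p.2 * (zeta (List.replicate p.2 2) : ℂ))) = d := by
    -- The convolutions are the coefficients of A(x)A(-x), with A the generating series of the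
    -- ζ({2}^k). This product is even in x, so `d` vanishes at odd indices; at x = -t^2 it is the
    -- product of the values of `csinc` at πt and iπt.
    refine eq_of_hasSum_pow (f := fun x => (∑' k : ℕ, x ^ k * (zeta (List.replicate k 2) : ℂ))
      * ∑' k : ℕ, (-x) ^ k * (zeta (List.replicate k 2) : ℂ))
      (by norm_num : (0 : ℝ) < 1 / 2) (fun x hx => ?_) fun x hx => ?_
    · have h1 := summable_norm_mul_zeta_replicate le_rfl hx
      have h2 := summable_norm_mul_zeta_replicate (c := -x) le_rfl (by rwa [norm_neg])
      rw [tsum_mul_tsum_eq_tsum_sum_antidiagonal_of_summable_norm h1 h2]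
      refine (summable_norm_sum_mul_antidiagonal_of_summable_norm h1 h2).of_norm.hasSum.congr_fun
        fun m => ?_
      rw [Finset.mul_sum]
      refine Finset.sum_congr rfl fun p hp => ?_
      rw [← Finset.HasAntidiagonal.mem_antidiagonal.1 hp, pow_add, neg_pow x]
      ring
    · obtain ⟨t, ht⟩ := IsAlgClosed.exists_pow_nat_eq (-x) (by norm_num : 0 < 2)
      obtain rfl : x = -t ^ 2 := by rw [ht, neg_neg]
      have e : -(-t ^ 2) = -(Complex.I * t) ^ 2 := by
        rw [mul_pow, Complex.I_sq]
        ring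
      have hx' : ‖-(Complex.I * t) ^ 2‖ < 1 / 2 := by
        rwa [← e, norm_neg]
      rw [e, tendsto_nhds_unique (tendsto_prod_one_add le_rfl hx) (tendsto_prod_csinc t),
        tendsto_nhds_unique (tendsto_prod_one_add le_rfl hx')
        (tendsto_prod_csinc (Complex.I * t)), mul_left_comm (Real.pi : ℂ) Complex.I t]
      have hinj : Function.Injective fun k : ℕ => 2 * k := fun a b h => by
        simp only at h
        omega
      rw [← hinj.hasSum_iff]
      · refine (hasSum_csinc_mul_csinc (Real.pi * t)).congr_fun fun k => ?_
        simp only [Function.comp, hd, even_two_mul, if_true]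
        rw [Nat.mul_div_cancel_left k two_pos, mul_pow, pow_mul (-t ^ 2), pow_mul t]
        ring
      · intro m hm
        have : ¬ Even m := fun ⟨k, hk⟩ => hm ⟨k, by simp only; omega⟩
        simp [hd, this]
  have := congrFun h (2 * n)
  simp only [hd, even_two_mul, if_true] at this
  rw [Nat.mul_div_cancel_left n two_pos] at this
  exact_mod_cast this

/-! ### Formal polylogarithm series and the shuffle identity -/

section PolylogSeries


/-- The coefficients of the polylogarithm `Li_w`. -/
def polylogCoeff (w : List ℕ) : ℕ → ℝ
  | 0 => hsum w 0
  | n + 1 => hsum w (n + 1) - hsum w n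

@[simp] theorem polylogCoeff_nil_zero : polylogCoeff [] 0 = 1 := rfl

@[simp] theorem polylogCoeff_nil_succ (n : ℕ) : polylogCoeff [] (n + 1) = 0 := by
  simp [polylogCoeff]

@[simp] theorem polylogCoeff_cons_zero (s : ℕ) (w : List ℕ) : polylogCoeff (s :: w) 0 = 0 := by
  simp [polylogCoeff]

theorem polylogCoeff_cons_succ (s : ℕ) (w : List ℕ) (n : ℕ) :
    polylogCoeff (s :: w) (n + 1) = (((n + 1 : ℕ) : ℝ) ^ s)⁻¹ * hsum w n := by
  rw [polylogCoeff, hsum_cons_succ]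
  ring

theorem nat_mul_polylogCoeff_succ_cons (s : ℕ) (w : List ℕ) (n : ℕ) :
    (n : ℝ) * polylogCoeff ((s + 1) :: w) n = polylogCoeff (s :: w) n := by
  cases n with
  | zero => simp
  | succ n =>
    rw [polylogCoeff_cons_succ, polylogCoeff_cons_succ, pow_succ]
    have : ((n + 1 : ℕ) : ℝ) ≠ 0 := Nat.cast_ne_zero.2 n.succ_ne_zero
    field_simp

/-- Coefficient form of (1-z) d/dz Li_{1w} = Li_w: the numbers n c_n(1w) are harmonic sums of w, and
their increments are the coefficients of Li_w. -/
theorem succ_mul_polylogCoeff_one_cons (w : List ℕ) (n : ℕ) :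
    ((n : ℝ) + 1) * polylogCoeff (1 :: w) (n + 1)
      = n * polylogCoeff (1 :: w) n + polylogCoeff w n := by
  have h : ∀ n : ℕ, ((n : ℝ) + 1) * polylogCoeff (1 :: w) (n + 1) = hsum w n := fun n => by
    rw [polylogCoeff_cons_succ]
    push_cast
    field_simp
  rw [h]
  cases n with
  | zero => simp [polylogCoeff]
  | succ n =>
    have := h n
    push_cast
    rw [this, polylogCoeff]
    ring

theorem sum_polylogCoeff (w : List ℕ) (N : ℕ) :
    ∑ n ∈ Finset.range (N + 1), polylogCoeff w n = hsum w N := by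
  induction N with
  | zero => simp [polylogCoeff]
  | succ N ih =>
    rw [Finset.sum_range_succ, ih, polylogCoeff]
    ring

theorem polylogCoeff_nonneg (w : List ℕ) (n : ℕ) : 0 ≤ polylogCoeff w n := by
  cases n with
  | zero => exact hsum_nonneg w 0
  | succ n => exact sub_nonneg.2 (hsum_mono w n.le_succ)

theorem Converges.hasSum_polylogCoeff {w : List ℕ} (h : Converges w) :
    HasSum (polylogCoeff w) (zeta w) := by
  rw [hasSum_iff_tendsto_nat_of_nonneg (polylogCoeff_nonneg w), ← tendsto_add_atTop_iff_nat 1]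
  exact h.tendsto_hsum.congr fun N => (sum_polylogCoeff w N).symm

theorem tendsto_hsum_of_hasSum {w : List ℕ} {l : ℝ} (h : HasSum (polylogCoeff w) l) :
    Tendsto (hsum w) atTop (𝓝 l) :=
  ((tendsto_add_atTop_iff_nat 1).2 h.tendsto_sum_nat).congr fun N => sum_polylogCoeff w N

/-- The series `∑_{n,k} a_k c_n(w_k) T^k z^n`, as a power series in `z` over the ring of power
series in `T`, where `c_n(w)` are the coefficients of `Li_w`. -/
def wordSeries (a : ℕ → ℝ) (w : ℕ → List ℕ) : PowerSeries (PowerSeries ℝ) :=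
  PowerSeries.mk fun n => PowerSeries.mk fun k => a k * polylogCoeff (w k) n

open PowerSeries

theorem coeff_coeff_wordSeries (a : ℕ → ℝ) (w : ℕ → List ℕ) (n k : ℕ) :
    coeff k (coeff n (wordSeries a w)) = a k * polylogCoeff (w k) n := by
  rw [wordSeries, coeff_mk, coeff_mk]

theorem coeff_X_mul_derivative {R : Type*} [CommRing R] (f : PowerSeries R) (n : ℕ) :
    coeff n (X * derivative R f) = n * coeff n f := by
  cases n with
  | zero => simp
  | succ n =>
    rw [coeff_succ_X_mul, coeff_derivative]
    push_cast
    ring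

theorem coeff_succ_one_sub_X_mul_derivative {R : Type*} [CommRing R] (f : PowerSeries R) (n : ℕ) :
    coeff n ((1 - X) * derivative R f) = (n + 1) * coeff (n + 1) f - n * coeff n f := by
  rw [sub_mul, one_mul, map_sub, coeff_X_mul_derivative, coeff_derivative, mul_comm]

theorem coeff_nat_mul (n m : ℕ) (f : PowerSeries ℝ) :
    coeff m ((n : PowerSeries ℝ) * f) = n * coeff m f := by
  rw [← map_natCast (C (R := ℝ)), coeff_C_mul]

theorem one_sub_X_mul_derivative_wordSeries (a : ℕ → ℝ) (w : ℕ → List ℕ) :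
    (1 - X) * derivative _ (wordSeries a fun k => 1 :: w k) = wordSeries a w := by
  ext n k
  rw [coeff_succ_one_sub_X_mul_derivative, map_sub, ← Nat.cast_succ, coeff_nat_mul, coeff_nat_mul]
  simp only [coeff_coeff_wordSeries]
  have := succ_mul_polylogCoeff_one_cons (w k) n
  push_cast
  linear_combination a k * this

theorem X_mul_derivative_wordSeries (a : ℕ → ℝ) (s : ℕ) (w : ℕ → List ℕ) :
    X * derivative _ (wordSeries a fun k => (s + 1) :: w k) = wordSeries a fun k => s :: w k := by
  ext n k
  rw [coeff_X_mul_derivative, coeff_nat_mul]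
  simp only [coeff_coeff_wordSeries]
  linear_combination a k * nat_mul_polylogCoeff_succ_cons s (w k) n

/-- The operator z d/dz kills the empty words at indices below d and lowers the first letter of the
others; reindexing by d produces the factor cT^d. -/
theorem X_mul_derivative_wordSeries_of_succ {a b : ℕ → ℝ} {c : ℝ} {d : ℕ} {w v : ℕ → List ℕ}
    {s : ℕ} (hd : ∀ k < d, w k = []) (ha : ∀ k, a (k + d) = c * b k)
    (hw : ∀ k, w (k + d) = (s + 1) :: v k) :
    X * derivative _ (wordSeries a w)
      = C (C c * X ^ d) * wordSeries b fun k => s :: v k := by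
  ext n k
  rw [coeff_X_mul_derivative, coeff_nat_mul, coeff_C_mul, mul_assoc, coeff_C_mul, coeff_X_pow_mul']
  simp only [coeff_coeff_wordSeries]
  split_ifs with h
  · obtain ⟨k, rfl⟩ := Nat.exists_eq_add_of_le' h
    rw [Nat.add_sub_cancel, hw, ha]
    linear_combination c * b k * nat_mul_polylogCoeff_succ_cons s (v k) n
  · rw [hd k (by omega)]
    cases n <;> simp

/-- The differential system satisfied by the product of the series of `(T y_2)^*` and
`(-T y_2)^*`, compared with the one satisfied by the series of `(-4 T^2 y_3 y_1)^*`. -/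
theorem derivation_system_mul {R S : Type*} [CommRing R] [CommRing S] [IsDomain S] {_ : Algebra R S}
    (D : Derivation R S S) {x T f f' g g' h q p m : S} (hx : x ≠ 0) (hx1 : 1 - x ≠ 0)
    (hT : D T = 0) (df : x * D f = T * g) (df' : x * D f' = -T * g') (dg : (1 - x) * D g = f)
    (dg' : (1 - x) * D g' = f') (dh : x * D h = -4 * T ^ 2 * q) (dq : x * D q = p)
    (dp : (1 - x) * D p = m) (dm : (1 - x) * D m = h) :
    x * D (f * f' - h) = T * (g * f' - f * g' + 4 * T * q) ∧
    x * D (g * f' - f * g' + 4 * T * q) = -2 * T * (g * g' - 2 * p) ∧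
    (1 - x) * D (g * g' - 2 * p) = g * f' + f * g' - 2 * m ∧
    (1 - x) * D (g * f' + f * g' - 2 * m) = 2 * (f * f' - h) := by
  have d4 : D 4 = 0 := by simpa using D.map_natCast 4
  have d2 : D 2 = 0 := by simpa using D.map_natCast 2
  -- The second and fourth equations mix derivatives known after multiplication by x with others
  -- known after multiplication by 1 - x. They are checked after multiplying by the missing factor,
  -- where the unwanted products f f' and g g' cancel.
  refine ⟨?_, mul_left_cancel₀ hx1 ?_, ?_, mul_left_cancel₀ hx ?_⟩ <;>
    simp only [map_sub, map_add, Derivation.leibniz, smul_eq_mul, hT, d4, d2]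
  · linear_combination f * df' + f' * df - dh
  · linear_combination (1 - x) * g * df' + x * f' * dg - (1 - x) * g' * df - x * f * dg'
      + (1 - x) * 4 * T * dq
  · linear_combination g * dg' + g' * dg - 2 * dp
  · linear_combination x * f' * dg + (1 - x) * g * df' + (1 - x) * g' * df + x * f * dg'
      - 2 * x * dm

/-- Uniqueness for the differential system of the series `∑ (-4)^k T^{2k} Li_{{3,1}^k}`. -/
theorem eq_zero_of_derivative_system {y k p m : PowerSeries (PowerSeries ℝ)} {τ σ : PowerSeries ℝ}
    (hy : X * derivative _ y = C τ * k) (hk : X * derivative _ k = C σ * p)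
    (hp : (1 - X) * derivative _ p = m) (hm : (1 - X) * derivative _ m = C 2 * y)
    (hy0 : coeff 0 y = 0) (hk0 : coeff 0 k = 0) (hp0 : coeff 0 p = 0) (hm0 : coeff 0 m = 0) :
    y = 0 := by
  have key : ∀ n, coeff n y = 0 ∧ coeff n k = 0 ∧ coeff n p = 0 ∧ coeff n m = 0 := by
    intro n
    induction n with
    | zero => exact ⟨hy0, hk0, hp0, hm0⟩
    | succ n ih =>
      obtain ⟨iy, ik, ip, im⟩ := ih
      have hn' : ((n + 1 : ℕ) : PowerSeries ℝ) ≠ 0 := by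
        rw [← map_natCast (C (R := ℝ)), Ne, map_eq_zero_iff _ C_injective]
        exact Nat.cast_ne_zero.2 n.succ_ne_zero
      have hn : ((n : PowerSeries ℝ) + 1) ≠ 0 := by rwa [← Nat.cast_succ]
      -- The equations with 1 - X give the coefficients n+1 of m and p from those of index n. The
      -- equations with X stay at index n+1, so k must follow p and y must follow k.
      have e1 := congrArg (coeff n) hm
      rw [coeff_succ_one_sub_X_mul_derivative, im, mul_zero, sub_zero, coeff_C_mul, iy,
        mul_zero] at e1
      have e2 := congrArg (coeff n) hp
      rw [coeff_succ_one_sub_X_mul_derivative, ip, mul_zero, sub_zero, im] at e2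
      have jm := (mul_eq_zero.1 e1).resolve_left hn
      have jp := (mul_eq_zero.1 e2).resolve_left hn
      have e3 := congrArg (coeff (n + 1)) hk
      rw [coeff_X_mul_derivative, coeff_C_mul, jp, mul_zero] at e3
      have jk := (mul_eq_zero.1 e3).resolve_left hn'
      have e4 := congrArg (coeff (n + 1)) hy
      rw [coeff_X_mul_derivative, coeff_C_mul, jk, mul_zero] at e4
      exact ⟨(mul_eq_zero.1 e4).resolve_left hn', jk, jp, jm⟩
  ext1 n
  rw [(key n).1, map_zero]

theorem coeff_zero_wordSeries_cons (a : ℕ → ℝ) (s : ℕ → ℕ) (w : ℕ → List ℕ) :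
    coeff 0 (wordSeries a fun k => s k :: w k) = 0 := by
  ext k
  rw [coeff_coeff_wordSeries]
  simp

theorem coeff_zero_wordSeries {a : ℕ → ℝ} {w : ℕ → List ℕ} (ha : a 0 = 1) (h0 : w 0 = [])
    (hw : ∀ k, a (k + 1) = 0 ∨ ∃ s v, w (k + 1) = s :: v) : coeff 0 (wordSeries a w) = 1 := by
  ext k
  rw [coeff_coeff_wordSeries]
  cases k with
  | zero => simp [ha, h0]
  | succ k =>
    rcases hw k with h | ⟨s, v, h⟩
    · simp [h, coeff_one]
    · simp [h, coeff_one]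

/-- The coefficient sequence of `∑ (-4)^k T^{2k}`. -/
def evenCoeff (m : ℕ) : ℝ := if Even m then (-4) ^ (m / 2) else 0

theorem evenCoeff_add_two (m : ℕ) : evenCoeff (m + 2) = -4 * evenCoeff m := by
  unfold evenCoeff
  have : Even (m + 2) ↔ Even m := by simp [Nat.even_add]
  simp only [this]
  split_ifs
  · rw [Nat.add_div_right m two_pos, pow_succ, mul_comm]
  · simp

/-- The shuffle product of `(T y_2)^*` and `(-T y_2)^*` is `(-4 T^2 y_3 y_1)^*`. -/
theorem wordSeries_two_mul_wordSeries_two :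
    wordSeries (fun _ => 1) (fun k => List.replicate k 2)
      * wordSeries (fun k => (-1) ^ k) (fun k => List.replicate k 2)
      = wordSeries evenCoeff fun m => wordPow [3, 1] (m / 2) := by
  set f := wordSeries (fun _ => 1) (fun k => List.replicate k 2) with hf
  set f' := wordSeries (fun k => (-1) ^ k) (fun k => List.replicate k 2) with hf'
  set g := wordSeries (fun _ => 1) (fun k => 1 :: List.replicate k 2) with hg
  set g' := wordSeries (fun k => (-1) ^ k) (fun k => 1 :: List.replicate k 2) with hg'
  set w : ℕ → List ℕ := fun m => wordPow [3, 1] (m / 2) with hw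
  set h := wordSeries evenCoeff w with hh
  set m := wordSeries evenCoeff (fun k => 1 :: w k) with hm
  set p := wordSeries evenCoeff (fun k => 1 :: 1 :: w k) with hp
  set q := wordSeries evenCoeff (fun k => 2 :: 1 :: w k) with hq
  set T : PowerSeries (PowerSeries ℝ) := C X with hT
  have df : X * derivative _ f = T * g := by
    have := X_mul_derivative_wordSeries_of_succ (a := fun _ => 1) (b := fun _ => 1) (c := 1)
      (d := 1) (w := fun k => List.replicate k 2) (v := fun k => List.replicate k 2) (s := 1)
      (fun k hk => by simp [Nat.lt_one_iff.1 hk]) (fun k => by simp)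
      (fun k => List.replicate_succ)
    rwa [map_one, one_mul, pow_one] at this
  have df' : X * derivative _ f' = -T * g' := by
    have := X_mul_derivative_wordSeries_of_succ (a := fun k => (-1) ^ k) (b := fun k => (-1) ^ k)
      (c := -1) (d := 1) (w := fun k => List.replicate k 2) (v := fun k => List.replicate k 2)
      (s := 1) (fun k hk => by simp [Nat.lt_one_iff.1 hk]) (fun k => by ring)
      (fun k => List.replicate_succ)
    rwa [map_neg, map_one, neg_one_mul, pow_one, map_neg] at this
  have dg : (1 - X) * derivative _ g = f := one_sub_X_mul_derivative_wordSeries _ _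
  have dg' : (1 - X) * derivative _ g' = f' := one_sub_X_mul_derivative_wordSeries _ _
  -- The index of `w` counts powers of T, so one more block 3,1 moves it by two and yields T^2.
  have dh : X * derivative _ h = C (C (-4) * X ^ 2) * q := by
    refine X_mul_derivative_wordSeries_of_succ (s := 2) (v := fun k => 1 :: w k)
      (fun k hk => ?_) evenCoeff_add_two (fun k => ?_)
    · simp only [hw, Nat.div_eq_of_lt hk, wordPow_zero]
    · simp only [hw]
      rw [Nat.add_div_right k two_pos, wordPow_succ]
      rfl
  have dq : X * derivative _ q = p := X_mul_derivative_wordSeries _ _ _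
  have dp : (1 - X) * derivative _ p = m := one_sub_X_mul_derivative_wordSeries _ _
  have dm : (1 - X) * derivative _ m = h := one_sub_X_mul_derivative_wordSeries _ _
  have hX : (1 - X : PowerSeries (PowerSeries ℝ)) ≠ 0 := by
    intro h0
    have := congrArg (coeff 0) h0
    simp at this
  have c4 : C (C (-4 : ℝ) * X ^ 2) = -4 * T ^ 2 := by
    rw [map_mul, map_pow, map_neg, map_neg, map_ofNat, map_ofNat]
  have hfc : coeff 0 f = 1 := coeff_zero_wordSeries rfl rfl fun k => Or.inr ⟨2, _, List.replicate_succ⟩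
  have hfc' : coeff 0 f' = 1 :=
    coeff_zero_wordSeries (by simp) rfl fun k => Or.inr ⟨2, _, List.replicate_succ⟩
  have hgc : coeff 0 g = 0 := coeff_zero_wordSeries_cons _ _ _
  have hgc' : coeff 0 g' = 0 := coeff_zero_wordSeries_cons _ _ _
  have hqc : coeff 0 q = 0 := coeff_zero_wordSeries_cons _ _ _
  have hpc : coeff 0 p = 0 := coeff_zero_wordSeries_cons _ _ _
  have hmc : coeff 0 m = 0 := coeff_zero_wordSeries_cons _ _ _
  have hhc : coeff 0 h = 1 := by
    refine coeff_zero_wordSeries (by simp [evenCoeff]) rfl fun k => ?_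
    rcases Nat.even_or_odd' (k + 1) with ⟨i, hi | hi⟩
    · obtain ⟨j, rfl⟩ := Nat.exists_eq_succ_of_ne_zero (by omega : i ≠ 0)
      refine Or.inr ⟨3, 1 :: wordPow [3, 1] j, ?_⟩
      simp only [hw]
      rw [hi, Nat.mul_div_cancel_left _ two_pos, Nat.succ_eq_add_one, wordPow_succ]
      rfl
    · exact Or.inl (if_neg (by rw [hi]; simp))
  rw [← sub_eq_zero]
  have dT : derivative (PowerSeries ℝ) T = 0 := derivative_C
  rw [c4] at dh
  obtain ⟨e1, e2, e3, e4⟩ := derivation_system_mul _ X_ne_zero hX dT df df' dg dg' dh dq dp dm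
  have c2 : C (-2 * X : PowerSeries ℝ) = -2 * T := by
    rw [map_mul, map_neg, map_ofNat]
  have c2' : C (2 : PowerSeries ℝ) = 2 := map_ofNat C 2
  rw [← c2] at e2
  rw [← c2'] at e4
  simp only [coeff_zero_eq_constantCoeff_apply] at hfc hfc' hgc hgc' hqc hpc hmc hhc
  refine eq_zero_of_derivative_system e1 e2 e3 e4 ?_ ?_ ?_ ?_ <;>
    simp only [coeff_zero_eq_constantCoeff_apply, map_sub, map_add, map_mul, hfc, hfc', hgc, hgc',
      hqc, hpc, hmc, hhc] <;>
    ring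

/-- Extract the coefficient of T^{2n} in the shuffle identity and sum over the powers of z. The
right side is a finite sum of Cauchy products of absolutely convergent series, so the convergence of
ζ({3,1}^n) comes out together with its value. -/
theorem hasSum_polylogCoeff_three_one (n : ℕ) :
    HasSum (polylogCoeff (wordPow [3, 1] n))
      (2 * Real.pi ^ (4 * n) / ((4 * n + 2).factorial : ℝ)) := by
  have h1 : ∀ l, (-4 : ℝ) ^ n * polylogCoeff (wordPow [3, 1] n) l
      = ∑ p ∈ Finset.HasAntidiagonal.antidiagonal (2 * n),
        ∑ q ∈ Finset.HasAntidiagonal.antidiagonal l, polylogCoeff (List.replicate p.1 2) q.1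
          * ((-1) ^ p.2 * polylogCoeff (List.replicate p.2 2) q.2) := fun l => by
    have h := congrArg (fun F => coeff (2 * n) (coeff l F)) wordSeries_two_mul_wordSeries_two
    simp only [coeff_mul, map_sum, coeff_coeff_wordSeries, one_mul] at h
    rw [Finset.sum_comm, h, evenCoeff, if_pos (even_two_mul n), Nat.mul_div_cancel_left n two_pos]
  have h2 : ∀ p : ℕ × ℕ, HasSum (fun l => ∑ q ∈ Finset.HasAntidiagonal.antidiagonal l,
      polylogCoeff (List.replicate p.1 2) q.1
        * ((-1) ^ p.2 * polylogCoeff (List.replicate p.2 2) q.2))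
      (zeta (List.replicate p.1 2) * ((-1) ^ p.2 * zeta (List.replicate p.2 2))) := fun p => by
    have e1 := (converges_replicate le_rfl p.1).hasSum_polylogCoeff
    have e2 := (converges_replicate le_rfl p.2).hasSum_polylogCoeff.mul_left ((-1) ^ p.2)
    rw [← e1.tsum_eq, ← e2.tsum_eq,
      tsum_mul_tsum_eq_tsum_sum_antidiagonal_of_summable_norm e1.summable.norm e2.summable.norm]
    exact (summable_norm_sum_mul_antidiagonal_of_summable_norm
      e1.summable.norm e2.summable.norm).of_norm.hasSum
  have h3 := hasSum_sum fun p (_ : p ∈ Finset.HasAntidiagonal.antidiagonal (2 * n)) => h2 p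
  rw [sum_zeta_two_mul_zeta_two] at h3
  simp only [← h1] at h3
  exact (hasSum_mul_left_iff (pow_ne_zero n (by norm_num))).1 h3

theorem tendsto_hsum_three_one (n : ℕ) :
    Tendsto (hsum (wordPow [3, 1] n)) atTop
      (𝓝 (2 * Real.pi ^ (4 * n) / ((4 * n + 2).factorial : ℝ))) :=
  tendsto_hsum_of_hasSum (hasSum_polylogCoeff_three_one n)

end PolylogSeries


/-! ### Star values and the reflection formula -/

theorem wordPow_singleton_gammaReg_eq_zeta {r : ℕ} (hr : 2 ≤ r) (k : ℕ) :
    gammaReg (wordPow [r] k) = zeta (wordPow [r] k) := by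
  rw [wordPow_singleton]
  exact (converges_replicate hr k).gammaReg_eq_zeta

theorem starConverges_zeta_iff {r : ℕ} (hr : 2 ≤ r) (c : ℂ) :
    StarConverges zeta c [r] ↔ StarConverges gammaReg c [r] := by
  simp only [StarConverges, wordPow_singleton_gammaReg_eq_zeta hr]

theorem starValue_gammaReg_eq_zeta {r : ℕ} (hr : 2 ≤ r) (c : ℂ) :
    starValue gammaReg c [r] = starValue zeta c [r] := by
  simp only [starValue, wordPow_singleton_gammaReg_eq_zeta hr]

theorem starConverges_gammaReg {r : ℕ} (hr : 1 ≤ r) {z c : ℂ} (hz : ‖z‖ < 1) (hc : z ^ r = c) :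
    StarConverges gammaReg c [r] :=
  hc ▸ (hasSum_gammaReg_ell hr hz).summable

theorem starValue_gammaReg {r : ℕ} (hr : 1 ≤ r) {z c : ℂ} (hz : ‖z‖ < 1) (hc : z ^ r = c) :
    starValue gammaReg c [r] = (GammaY r (1 + z))⁻¹ :=
  hc ▸ (hasSum_gammaReg_ell hr hz).tsum_eq

theorem hasSum_zeta_two (t : ℂ) :
    HasSum (fun k : ℕ => (-t ^ 2) ^ k * (zeta (wordPow [2] k) : ℂ)) (csinc (Real.pi * t)) := by
  refine (hasSum_csinc (Real.pi * t)).congr_fun fun k => ?_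
  rw [wordPow_singleton, zeta_replicate_two, mul_pow, ← mul_neg, mul_pow]
  push_cast
  ring

theorem hasSum_zeta_four (t : ℂ) :
    HasSum (fun k : ℕ => (-t ^ 4) ^ k * (zeta (wordPow [4] k) : ℂ))
      (csinc (Real.pi * t) * csinc (Real.pi * (Complex.I * t))) := by
  rw [mul_left_comm (Real.pi : ℂ) Complex.I t]
  refine (hasSum_csinc_mul_csinc (Real.pi * t)).congr_fun fun k => ?_
  rw [wordPow_singleton, zeta_replicate_four, neg_pow (t ^ 4), neg_pow 4, mul_pow]
  push_cast
  ring

theorem zeta_three_one (k : ℕ) :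
    zeta (wordPow [3, 1] k) = 2 * Real.pi ^ (4 * k) / ((4 * k + 2).factorial : ℝ) :=
  zeta_eq_of_tendsto_hsum (tendsto_hsum_three_one k)

theorem hasSum_zeta_three_one (t : ℂ) :
    HasSum (fun k : ℕ => (-4 * t ^ 4) ^ k * (zeta (wordPow [3, 1] k) : ℂ))
      (csinc (Real.pi * t) * csinc (Real.pi * (Complex.I * t))) := by
  rw [mul_left_comm (Real.pi : ℂ) Complex.I t]
  refine (hasSum_csinc_mul_csinc (Real.pi * t)).congr_fun fun k => ?_
  rw [zeta_three_one, mul_pow, mul_pow]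
  push_cast
  ring

theorem GammaY_one_add_inv (r : ℕ) (z : ℂ) : (GammaY r (1 + z))⁻¹ = Complex.exp (ell r z) := by
  rw [GammaY, add_sub_cancel_left, ← Complex.exp_neg, neg_neg]

/-- The reflection formula for `Γ_{y_1}` at the level of the series. -/
theorem ell_one_add_ell_one_neg {t : ℂ} (ht : ‖t‖ < 1) :
    ell 1 t + ell 1 (-t) = ell 2 (Complex.I * t) := by
  have ht' : ‖-t‖ < 1 := by rwa [norm_neg]
  have hI : ‖Complex.I * t‖ < 1 := by rwa [norm_mul, Complex.norm_I, one_mul]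
  have h1 := (summable_sigma_mul (r := 1) le_rfl ht).hasSum
  have h2 := (summable_sigma_mul (r := 1) le_rfl ht').hasSum
  have h := h1.add h2
  rw [ell_eq le_rfl ht, ell_eq le_rfl ht', ell_eq (by norm_num) hI]
  simp only [pow_one] at h ⊢
  have hinj : Function.Injective fun k : ℕ => 2 * k + 1 := fun a b h => by
    simp only at h
    omega
  -- Index m carries t^{m+1}, so even m are the odd powers, which cancel (γ among them). The terms
  -- at m = 2k+1 double, which compensates the denominator 2(k+1).
  rw [← hinj.hasSum_iff] at h
  · rw [← h.tsum_eq]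
    refine tsum_congr fun k => ?_
    simp only [Function.comp, one_mul]
    have e1 : (-1 : ℂ) ^ (2 * k + 1) = -1 := by rw [pow_succ, pow_mul]; simp
    have e2 : (-t) ^ (2 * k + 1 + 1) = t ^ (2 * k + 1 + 1) :=
      Even.neg_pow ⟨k + 1, by ring⟩ t
    have e3 : (-1 : ℂ) ^ k * (-1) ^ (k + 1) = -1 := by
      rw [pow_succ, ← mul_assoc, ← mul_pow]
      simp
    have : (k : ℂ) + 1 ≠ 0 := Nat.cast_add_one_ne_zero k
    rw [e1, e2, mul_pow, Complex.I_sq, mul_pow, ← pow_mul,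
      show 2 * k + 1 + 1 = 2 * (k + 1) by ring]
    push_cast
    field_simp
    linear_combination -2 * (sigma (2 * (k + 1)) : ℂ) * t ^ (2 * (k + 1)) * e3
  · intro m hm
    obtain ⟨k, rfl⟩ : ∃ k, m = 2 * k := by
      rcases Nat.even_or_odd' m with ⟨k, h | h⟩
      · exact ⟨k, h⟩
      · exact absurd ⟨k, h.symm⟩ hm
    rw [Odd.neg_pow ⟨k, rfl⟩ t]
    ring

/-- The condition -z^r = t^r removes the alternating sign; it is used with z = it for r = 2 and z =
ξt, ξ^4 = -1, for r = 4. -/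
theorem hasSum_riemannZeta_ell {r : ℕ} (hr : 2 ≤ r) {z t : ℂ} (hz : ‖z‖ < 1)
    (ht : -z ^ r = t ^ r) :
    HasSum (fun k : ℕ => riemannZeta ((r * (k + 1) : ℕ) : ℂ) * t ^ (r * (k + 1))
      / ((k + 1 : ℕ) : ℂ)) (-ell r z) := by
  have hzr : ‖z ^ r‖ < 1 := by
    rw [norm_pow]
    exact pow_lt_one₀ (norm_nonneg z) hz (by omega)
  rw [ell_eq (by omega) hz]
  refine (summable_sigma_mul (by omega) hzr).hasSum.neg.congr_fun fun k => ?_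
  rw [sigma_eq_riemannZeta (by nlinarith [Nat.zero_le k]), pow_mul, ← ht, neg_pow (z ^ r)]
  ring

end Polyzeta

end

/-! ### The regularization identities and the resulting values -/

theorem mainTheorem12 :
    -- the finite parts that define `γ` exist
    (∀ r : ℕ, 1 ≤ r → ∀ k : ℕ, Polyzeta.IsFinitePart
      (Polyzeta.harmonicSum (Polyzeta.wordPow [r] k))
      (Polyzeta.gammaReg (Polyzeta.wordPow [r] k))) ∧
    -- first family of regularization identities
    (∀ t : ℂ, ‖t‖ < 1 →
      (Polyzeta.StarConverges Polyzeta.gammaReg (-t ^ 2) [2] ∧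
        Polyzeta.StarConverges Polyzeta.gammaReg t [1] ∧
        Polyzeta.StarConverges Polyzeta.gammaReg (-t) [1] ∧
        Polyzeta.StarConverges Polyzeta.zeta (-t ^ 2) [2]) ∧
      Polyzeta.starValue Polyzeta.gammaReg (-t ^ 2) [2]
        = (Polyzeta.GammaY 2 (1 + Complex.I * t))⁻¹ ∧
      Polyzeta.starValue Polyzeta.gammaReg t [1] = (Polyzeta.GammaY 1 (1 + t))⁻¹ ∧
      Polyzeta.starValue Polyzeta.gammaReg (-t) [1] = (Polyzeta.GammaY 1 (1 - t))⁻¹ ∧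
      Polyzeta.starValue Polyzeta.gammaReg (-t ^ 2) [2]
        = Polyzeta.starValue Polyzeta.gammaReg t [1]
          * Polyzeta.starValue Polyzeta.gammaReg (-t) [1] ∧
      (Polyzeta.GammaY 2 (1 + Complex.I * t))⁻¹
        = (Polyzeta.GammaY 1 (1 + t))⁻¹ * (Polyzeta.GammaY 1 (1 - t))⁻¹ ∧
      (∃ L : ℂ,
        HasSum (fun k : ℕ => riemannZeta ((2 * (k + 1) : ℕ) : ℂ) * t ^ (2 * (k + 1))
          / ((k + 1 : ℕ) : ℂ)) L ∧
        (Polyzeta.GammaY 2 (1 + Complex.I * t))⁻¹ = Complex.exp (-L) ∧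
        (t ≠ 0 → Complex.exp (-L) = Complex.sin (t * Real.pi) / (t * Real.pi))) ∧
      Polyzeta.starValue Polyzeta.gammaReg (-t ^ 2) [2]
        = Polyzeta.starValue Polyzeta.zeta (-t ^ 2) [2] ∧
      HasSum (fun k : ℕ => (t * Complex.I * Real.pi) ^ (2 * k) / ((2 * k + 1).factorial : ℂ))
        (Polyzeta.starValue Polyzeta.zeta (-t ^ 2) [2])) ∧
    -- second family of regularization identities
    (∀ t : ℂ, ‖t‖ < 1 →
      (Polyzeta.StarConverges Polyzeta.gammaReg (-t ^ 4) [4] ∧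
        Polyzeta.StarConverges Polyzeta.gammaReg (t ^ 2) [2] ∧
        Polyzeta.StarConverges Polyzeta.zeta (-t ^ 4) [4] ∧
        Polyzeta.StarConverges Polyzeta.zeta (t ^ 2) [2] ∧
        Polyzeta.StarConverges Polyzeta.zeta (-4 * t ^ 4) [3, 1]) ∧
      (∀ ξ : ℂ, ξ ^ 4 = -1 →
        Polyzeta.starValue Polyzeta.gammaReg (-t ^ 4) [4]
          = (Polyzeta.GammaY 4 (1 + ξ * t))⁻¹ ∧
        (Polyzeta.GammaY 4 (1 + ξ * t))⁻¹
          = (Polyzeta.GammaY 2 (1 + t))⁻¹ * (Polyzeta.GammaY 2 (1 + Complex.I * t))⁻¹) ∧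
      Polyzeta.starValue Polyzeta.gammaReg (t ^ 2) [2] = (Polyzeta.GammaY 2 (1 + t))⁻¹ ∧
      Polyzeta.starValue Polyzeta.gammaReg (-t ^ 4) [4]
        = Polyzeta.starValue Polyzeta.gammaReg (t ^ 2) [2]
          * Polyzeta.starValue Polyzeta.gammaReg (-t ^ 2) [2] ∧
      (∃ L : ℂ,
        HasSum (fun k : ℕ => riemannZeta ((4 * (k + 1) : ℕ) : ℂ) * t ^ (4 * (k + 1))
          / ((k + 1 : ℕ) : ℂ)) L ∧
        Polyzeta.starValue Polyzeta.gammaReg (-t ^ 4) [4] = Complex.exp (-L) ∧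
        (t ≠ 0 → Complex.exp (-L)
          = Complex.sin (Complex.I * t * Real.pi) / (Complex.I * t * Real.pi)
            * (Complex.sin (t * Real.pi) / (t * Real.pi)))) ∧
      Polyzeta.starValue Polyzeta.gammaReg (-t ^ 4) [4]
        = Polyzeta.starValue Polyzeta.zeta (-t ^ 4) [4] ∧
      Polyzeta.starValue Polyzeta.gammaReg (t ^ 2) [2]
        = Polyzeta.starValue Polyzeta.zeta (t ^ 2) [2] ∧
      Polyzeta.starValue Polyzeta.zeta (-t ^ 4) [4]
        = Polyzeta.starValue Polyzeta.zeta (-t ^ 2) [2]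
          * Polyzeta.starValue Polyzeta.zeta (t ^ 2) [2] ∧
      Polyzeta.starValue Polyzeta.zeta (-t ^ 4) [4]
        = Polyzeta.starValue Polyzeta.zeta (-4 * t ^ 4) [3, 1] ∧
      HasSum (fun k : ℕ => 2 * (-4) ^ k * (t * Real.pi) ^ (4 * k)
          / ((4 * k + 2).factorial : ℂ))
        (Polyzeta.starValue Polyzeta.zeta (-t ^ 4) [4])) ∧
    -- the resulting values
    (∀ k : ℕ,
      (Polyzeta.Converges (Polyzeta.wordPow [2] k) ∧
        Polyzeta.Converges (Polyzeta.wordPow [4] k) ∧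
        Polyzeta.Converges (Polyzeta.wordPow [3, 1] k)) ∧
      Polyzeta.zeta (Polyzeta.wordPow [2] k) / Real.pi ^ (2 * k)
        = 1 / ((2 * k + 1).factorial : ℝ) ∧
      Polyzeta.zeta (Polyzeta.wordPow [4] k) / (4 ^ k * Real.pi ^ (4 * k))
        = Polyzeta.zeta (Polyzeta.wordPow [3, 1] k) / Real.pi ^ (4 * k) ∧
      Polyzeta.zeta (Polyzeta.wordPow [3, 1] k) / Real.pi ^ (4 * k)
        = 2 / ((4 * k + 2).factorial : ℝ) ∧
      (∃ q : ℚ, Polyzeta.zeta (Polyzeta.wordPow [2] k) / Real.pi ^ (2 * k) = q) ∧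
      (∃ q : ℚ, Polyzeta.zeta (Polyzeta.wordPow [4] k) / (4 ^ k * Real.pi ^ (4 * k)) = q) ∧
      (∃ q : ℚ, Polyzeta.zeta (Polyzeta.wordPow [3, 1] k) / Real.pi ^ (4 * k) = q)) := by
  have e2 : ∀ t : ℂ, (Complex.I * t) ^ 2 = -t ^ 2 := fun t => by
    rw [mul_pow, Complex.I_sq, neg_one_mul]
  have nI : ∀ t : ℂ, ‖t‖ < 1 → ‖Complex.I * t‖ < 1 := fun t ht => by
    rwa [norm_mul, Complex.norm_I, one_mul]
  have g2 : ∀ t : ℂ, ‖t‖ < 1 → (Polyzeta.GammaY 2 (1 + Complex.I * t))⁻¹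
      = Polyzeta.csinc (Real.pi * t) := fun t ht => by
    rw [← Polyzeta.starValue_gammaReg (by norm_num) (nI t ht) (e2 t),
      Polyzeta.starValue_gammaReg_eq_zeta le_rfl]
    exact (Polyzeta.hasSum_zeta_two t).tsum_eq
  have z2 : ∀ t : ℂ, Polyzeta.starValue Polyzeta.zeta (-t ^ 2) [2]
      = Polyzeta.csinc (Real.pi * t) := fun t => (Polyzeta.hasSum_zeta_two t).tsum_eq
  have e2' : ∀ t : ℂ, -(Complex.I * t) ^ 2 = t ^ 2 := fun t => by rw [e2, neg_neg]
  have z2' : ∀ t : ℂ, Polyzeta.starValue Polyzeta.zeta (t ^ 2) [2]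
      = Polyzeta.csinc (Real.pi * (Complex.I * t)) := fun t => by rw [← z2, e2']
  have z4 : ∀ t : ℂ, Polyzeta.starValue Polyzeta.zeta (-t ^ 4) [4]
      = Polyzeta.csinc (Real.pi * t) * Polyzeta.csinc (Real.pi * (Complex.I * t)) := fun t =>
    (Polyzeta.hasSum_zeta_four t).tsum_eq
  have z31 : ∀ t : ℂ, Polyzeta.starValue Polyzeta.zeta (-4 * t ^ 4) [3, 1]
      = Polyzeta.csinc (Real.pi * t) * Polyzeta.csinc (Real.pi * (Complex.I * t)) := fun t =>
    (Polyzeta.hasSum_zeta_three_one t).tsum_eq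
  have hpi : (Real.pi : ℂ) ≠ 0 := Complex.ofReal_ne_zero.2 Real.pi_ne_zero
  refine ⟨fun r hr k => ?_, fun t ht => ?_, fun t ht => ?_, fun k => ?_⟩
  · rw [Polyzeta.harmonicSum_eq_hsum, Polyzeta.wordPow_singleton]
    exact Polyzeta.isFinitePart_gammaReg hr k
  · have ht' : ‖-t‖ < 1 := by rwa [norm_neg]
    have a1 := Polyzeta.starValue_gammaReg le_rfl ht (pow_one t)
    have a2 := Polyzeta.starValue_gammaReg le_rfl ht' (pow_one (-t))
    have a3 := Polyzeta.starValue_gammaReg (by norm_num) (nI t ht) (e2 t)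
    have a4 : (Polyzeta.GammaY 2 (1 + Complex.I * t))⁻¹
        = (Polyzeta.GammaY 1 (1 + t))⁻¹ * (Polyzeta.GammaY 1 (1 + -t))⁻¹ := by
      simp only [Polyzeta.GammaY_one_add_inv]
      rw [← Complex.exp_add, Polyzeta.ell_one_add_ell_one_neg ht]
    have c2 := Polyzeta.starConverges_gammaReg (by norm_num) (nI t ht) (e2 t)
    rw [sub_eq_add_neg]
    refine ⟨⟨c2, Polyzeta.starConverges_gammaReg le_rfl ht (pow_one t),
      Polyzeta.starConverges_gammaReg le_rfl ht' (pow_one (-t)),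
      (Polyzeta.starConverges_zeta_iff le_rfl _).2 c2⟩, a3, a1, a2, ?_, a4,
      ⟨_, Polyzeta.hasSum_riemannZeta_ell le_rfl (nI t ht) (e2' t), ?_, fun h0 => ?_⟩,
      Polyzeta.starValue_gammaReg_eq_zeta le_rfl _, ?_⟩
    · rw [a1, a2, a3, a4]
    · rw [neg_neg, Polyzeta.GammaY_one_add_inv]
    · rw [neg_neg, ← Polyzeta.GammaY_one_add_inv, g2 t ht,
        Polyzeta.csinc_of_ne_zero (mul_ne_zero hpi h0), mul_comm]
    · rw [z2]
      refine (Polyzeta.hasSum_csinc (Real.pi * t)).congr_fun fun k => ?_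
      have : (t * Complex.I * Real.pi) ^ 2 = -(Real.pi * t) ^ 2 := by
        linear_combination t ^ 2 * (Real.pi : ℂ) ^ 2 * Complex.I_sq
      rw [pow_mul, this]
  · have n4 : ∀ ξ : ℂ, ξ ^ 4 = -1 → ‖ξ * t‖ < 1 := fun ξ hξ => by
      have h1 : ‖ξ‖ ^ 4 = 1 := by rw [← norm_pow, hξ, norm_neg, norm_one]
      rwa [norm_mul, (pow_eq_one_iff_of_nonneg (norm_nonneg ξ) (by norm_num)).1 h1, one_mul]
    have e4 : ∀ ξ : ℂ, ξ ^ 4 = -1 → (ξ * t) ^ 4 = -t ^ 4 := fun ξ hξ => by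
      rw [mul_pow, hξ, neg_one_mul]
    -- Convergence and the series L do not involve ξ, so one fourth root of -1 serves for them.
    obtain ⟨ξ, hξ⟩ := IsAlgClosed.exists_pow_nat_eq (-1 : ℂ) (by norm_num : 0 < 4)
    have s4 := Polyzeta.starValue_gammaReg_eq_zeta (r := 4) (by norm_num) (-t ^ 4)
    have s2 := Polyzeta.starValue_gammaReg_eq_zeta (r := 2) le_rfl (t ^ 2)
    have s2' := Polyzeta.starValue_gammaReg_eq_zeta (r := 2) le_rfl (-t ^ 2)
    have a2 := Polyzeta.starValue_gammaReg (r := 2) (by norm_num) ht rfl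
    have a4 := fun (ξ : ℂ) (hξ : ξ ^ 4 = -1) =>
      Polyzeta.starValue_gammaReg (by norm_num) (n4 ξ hξ) (e4 ξ hξ)
    have c4 := Polyzeta.starConverges_gammaReg (by norm_num) (n4 ξ hξ) (e4 ξ hξ)
    have c2 := Polyzeta.starConverges_gammaReg (r := 2) (by norm_num) ht rfl
    refine ⟨⟨c4, c2, (Polyzeta.starConverges_zeta_iff (by norm_num) _).2 c4,
      (Polyzeta.starConverges_zeta_iff le_rfl _).2 c2,
      (Polyzeta.hasSum_zeta_three_one t).summable⟩, fun ξ hξ => ⟨a4 ξ hξ, ?_⟩, a2, ?_,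
      ⟨_, Polyzeta.hasSum_riemannZeta_ell (t := t) (by norm_num) (n4 ξ hξ)
        (by rw [e4 ξ hξ, neg_neg]), ?_, fun h0 => ?_⟩, s4, s2, ?_, ?_, ?_⟩
    -- The factorization of the inverse gamma functions is read off from the sine products on both
    -- sides.
    · rw [← a4 ξ hξ, ← a2, s4, s2, g2 t ht, z4, z2', mul_comm]
    · rw [s4, s2, s2', z4, z2', z2, mul_comm]
    · rw [neg_neg, ← Polyzeta.GammaY_one_add_inv, a4 ξ hξ]
    · rw [neg_neg, ← Polyzeta.GammaY_one_add_inv, ← a4 ξ hξ, s4, z4,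
        Polyzeta.csinc_of_ne_zero (mul_ne_zero hpi h0),
        Polyzeta.csinc_of_ne_zero (mul_ne_zero hpi (mul_ne_zero Complex.I_ne_zero h0)),
        mul_comm (Real.pi : ℂ), mul_comm (Real.pi : ℂ), mul_comm]
    · rw [z4, z2, z2']
    · rw [z4, z31]
    · rw [z4, mul_left_comm (Real.pi : ℂ) Complex.I t, mul_comm t]
      exact Polyzeta.hasSum_csinc_mul_csinc (Real.pi * t)
  · have p2 : Real.pi ^ (2 * k) ≠ 0 := pow_ne_zero _ Real.pi_ne_zero
    have p4 : Real.pi ^ (4 * k) ≠ 0 := pow_ne_zero _ Real.pi_ne_zero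
    have v2 : Polyzeta.zeta (Polyzeta.wordPow [2] k) / Real.pi ^ (2 * k)
        = 1 / ((2 * k + 1).factorial : ℝ) := by
      rw [Polyzeta.wordPow_singleton, Polyzeta.zeta_replicate_two]
      field_simp
    have v4 : Polyzeta.zeta (Polyzeta.wordPow [4] k) / (4 ^ k * Real.pi ^ (4 * k))
        = 2 / ((4 * k + 2).factorial : ℝ) := by
      rw [Polyzeta.wordPow_singleton, Polyzeta.zeta_replicate_four]
      field_simp
    have v31 : Polyzeta.zeta (Polyzeta.wordPow [3, 1] k) / Real.pi ^ (4 * k)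
        = 2 / ((4 * k + 2).factorial : ℝ) := by
      rw [Polyzeta.zeta_three_one]
      field_simp
    refine ⟨⟨?_, ?_, ?_⟩, v2, v4.trans v31.symm, v31, ⟨1 / ((2 * k + 1).factorial : ℚ), ?_⟩,
      ⟨2 / ((4 * k + 2).factorial : ℚ), ?_⟩, ⟨2 / ((4 * k + 2).factorial : ℚ), ?_⟩⟩
    · rw [Polyzeta.wordPow_singleton]
      exact Polyzeta.converges_replicate le_rfl k
    · rw [Polyzeta.wordPow_singleton]
      exact Polyzeta.converges_replicate (by norm_num) k
    · exact Polyzeta.converges_of_tendsto_hsum (Polyzeta.tendsto_hsum_three_one k)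
    · rw [v2]
      push_cast
      rfl
    · rw [v4]
      push_cast
      rfl
    · rw [v31]
      push_cast
      rfl
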